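/- Let $\mathbb{R}_d$ be the real Clifford algebra with imaginary units $e_1,\dots,e_d$ ($e_i^2=-1$, $e_ie_j=-e_je_i$ for $i\neq j$), with basis $e_A=e_{i_1}\cdots e_{i_r}$, $A=\{i_1<\dots<i_r\}$, and conjugation $\overline{s}=\sum_A(-1)^{|A|(|A|+1)/2}s_Ae_A$. Let $\mathbb{R}^{d+1}=\{s_0+s_1e_1+\dots+s_de_d\}$ be the paravectors, with Euclidean modulus $|s|$ and imaginary part $\Im(s)=s_1e_1+\dots+s_de_d$, and let $\mathbb{S}=\{J\in\mathbb{R}^{d+1}: J_0=0,\,|J|=1\}$ and $\mathbb{C}_J=\{x+Jy: x,y\in\mathbb{R}\}$. A set $U\subseteq\mathbb{R}^{d+1}$ is axially symmetric if $s\in U$ implies $s_0+J|\Im(s)|\in U$ for all $J\in\mathbb{S}$. For $U$ open and axially symmetric, $f:U\to\mathbb{R}_d$ is left (resp. right) slice hyperholomorphic if there are continuously differentiable $f_0,f_1:\{(x,y): x+\mathbb{S}y\subseteq U\}\to\mathbb{R}_d$ with $f(x+Jy)=f_0(x,y)+Jf_1(x,y)$ (resp. $f_0(x,y)+f_1(x,y)J$)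 for all $J\in\mathbb{S}$, $f_0(x,-y)=f_0(x,y)$, $f_1(x,-y)=-f_1(x,y)$, $\partial_xf_0=\partial_yf_1$ and $\partial_yf_0=-\partial_xf_1$; $f$ is intrinsic if $f_0,f_1$ can be chosen real valued. Put $f^\#(s):=\overline{f(\overline{s})}$. Let $V=\{\sum_Av_A\otimes e_A: v_A\in V_{\mathbb{R}}\}$ be the Hilbert module over $\mathbb{R}_d$ built from a real Hilbert space $V_{\mathbb{R}}$, with inner product $\langle v,w\rangle=\sum_{A,B}\langle v_A,w_B\rangle_{\mathbb{R}}\,\overline{e_A}e_B$ and norm $\|v\|^2=\sum_A\|v_A\|^2$, and let $\mathcal{B}(V)$ be the bounded right-linear operators on $V$. For $T\in\mathcal{B}(V)$ the adjoint $T^*$ is determined by $\operatorname{Sc}\langle T^*w,v\rangle=\operatorname{Sc}\langle w,Tv\rangle$, where $\operatorname{Sc}$ is the real part (the $e_\emptyset$-coefficient). Put $Q_s[T]=T^2-2s_0T+|s|^2$ and $\sigma_S(T)=\{s\in\mathbb{R}^{d+1}: Q_s[T]^{-1}\notin\mathcal{B}(V)\}$, and for $s\notin\sigma_S(T)$ let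 $S_L^{-1}(s,T)=Q_s[T]^{-1}\overline{s}-TQ_s[T]^{-1}$ and $S_R^{-1}(s,T)=(\overline{s}-T)Q_s[T]^{-1}$, where Clifford numbers act on $V$ by left multiplication. For an axially symmetric open $U'\supseteq\sigma_S(T)$ and $f$ left (resp. right) slice hyperholomorphic on $U'$, the bounded $S$-functional calculus is $$f(T)=\frac1{2\pi}\int_{\partial U\cap\mathbb{C}_J}S_L^{-1}(s,T)\,ds_J\,f(s)\qquad\Big(\text{resp. }f(T)=\frac1{2\pi}\int_{\partial U\cap\mathbb{C}_J}f(s)\,ds_J\,S_R^{-1}(s,T)\Big),\qquad ds_J=ds\,(-J),$$ where $J\in\mathbb{S}$ is arbitrary and $U$ is any axially symmetric open set with $\sigma_S(T)\subseteq U\subseteq\overline{U}\subseteq U'$ such that $\partial U\cap\mathbb{C}_J$ consists of finitely many $C^1$ arcs which join up to closed curves and are positively oriented (in the plane $\mathbb{C}_J$ they have total winding number $1$ around the points of $U\cap\mathbb{C}_J$ and $0$ around the points of $\mathbb{C}_J\setminus\overline{U}$). **Theorem.** Let $T\in\mathcal{B}(V)$, let $U'\supseteq\sigma_S(T)$ be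 open and axially symmetric, and let $f$ be left or right slice hyperholomorphic on $U'$. Then $$f(T^*)=f^\#(T)^*.$$ Here, for left slice hyperholomorphic $f$, $f(T^*)$ is the left and $f^\#(T)$ the right $S$-functional calculus, and for right slice hyperholomorphic $f$ it is the other way round; the identity holds for every admissible choice of $(J,U)$ and of the boundary arcs on the left-hand side, and every admissible choice, possibly a different one, on the right-hand side. If moreover $f$ is intrinsic, then $f(T^*)=f(T)^*$, where each side may be computed with either the left or the right $S$-functional calculus, again for all admissible choices. -/

import Mathlib

open scoped symmDiff

/-- The quadratic form `v ↦ -(v₁² + ⋯ + v_d²)` on `ℝ^d`. -/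
noncomputable def cliffordForm (d : ℕ) : QuadraticForm ℝ (Fin d → ℝ) :=
  QuadraticMap.weightedSumSquares ℝ (fun _ : Fin d => (-1 : ℝ))

/-- The real Clifford algebra `ℝ_d`. -/
abbrev Cl (d : ℕ) : Type := CliffordAlgebra (cliffordForm d)

namespace Cl

variable {d : ℕ}

/-- The imaginary units `e_1, …, e_d`. -/
noncomputable def e (i : Fin d) : Cl d := CliffordAlgebra.ι (cliffordForm d) (Pi.single i 1)

/-- The basis vectors `e_A = e_{i_1} ⋯ e_{i_r}` for `A = {i_1 < ⋯ < i_r}`. -/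
noncomputable def eA (A : Finset (Fin d)) : Cl d := ((A.sort (· ≤ ·)).map e).prod

theorem e_mul_self (i : Fin d) : e i * e i = -1 := by
  rw [e, CliffordAlgebra.ι_sq_scalar]
  have h : cliffordForm d (Pi.single i 1) = -1 := by
    simp [cliffordForm, QuadraticMap.weightedSumSquares_apply, Pi.single_apply]
  rw [h, map_neg, map_one]

theorem e_anticomm {i j : Fin d} (h : i ≠ j) : e i * e j = -(e j * e i) := by
  have := CliffordAlgebra.ι_mul_ι_add_swap (Q := cliffordForm d) (Pi.single i 1) (Pi.single j 1)
  rw [eq_neg_iff_add_eq_zero, e, e, this]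
  have hk : QuadraticMap.polar (cliffordForm d) (Pi.single i 1) (Pi.single j 1) = 0 := by
    simp only [QuadraticMap.polar, cliffordForm, QuadraticMap.weightedSumSquares_apply,
      ← Finset.sum_sub_distrib]
    refine Finset.sum_eq_zero fun k _ => ?_
    by_cases h1 : k = i <;> by_cases h2 : k = j <;> simp_all
  simp [hk]

/-- The sign `(-1)^{#{a ∈ A : a ≤ i}}`, which satisfies `e_i e_A = sgn i A • e_{A ∆ {i}}`. -/
def sgn (i : Fin d) (A : Finset (Fin d)) : ℝ := ∏ a ∈ A, if a ≤ i then -1 else 1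

theorem sgn_mul_self (i : Fin d) (A : Finset (Fin d)) : sgn i A * sgn i A = 1 := by
  rw [sgn, ← Finset.prod_mul_distrib]
  exact Finset.prod_eq_one fun a _ => by split_ifs <;> norm_num

theorem sgn_symmDiff (i k : Fin d) (A : Finset (Fin d)) :
    sgn i (A ∆ {k}) = sgn i A * if k ≤ i then -1 else 1 := by
  by_cases h : k ∈ A
  · have h1 : A ∆ {k} = A.erase k := by ext x; by_cases x = k <;> simp_all [Finset.mem_symmDiff]
    rw [h1, sgn, sgn, ← Finset.mul_prod_erase A _ h]
    split_ifs <;> ring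
  · have h1 : A ∆ {k} = insert k A := by ext x; by_cases x = k <;> simp_all [Finset.mem_symmDiff]
    rw [h1, sgn, sgn, Finset.prod_insert h, mul_comm]

/-- The left regular representation of the vectors of `ℝ_d` in coordinates. -/
noncomputable def regVec : (Fin d → ℝ) →ₗ[ℝ] Module.End ℝ (Finset (Fin d) → ℝ) :=
  LinearMap.mk₂ ℝ (fun v x C => ∑ i, v i * (sgn i (C ∆ {i}) * x (C ∆ {i})))
    (fun v w x => by ext C; simp [add_mul, Finset.sum_add_distrib])
    (fun c v x => by ext C; simp [Finset.mul_sum, mul_assoc])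
    (fun v x y => by ext C; simp [mul_add, Finset.sum_add_distrib])
    (fun c v x => by
      ext C; simp only [Pi.smul_apply, smul_eq_mul, Finset.mul_sum]
      exact Finset.sum_congr rfl fun i _ => by ring)

theorem regVec_apply (v : Fin d → ℝ) (x : Finset (Fin d) → ℝ) (C : Finset (Fin d)) :
    regVec v x C = ∑ i, v i * (sgn i (C ∆ {i}) * x (C ∆ {i})) := rfl

theorem regVec_sq (v : Fin d → ℝ) :
    regVec v * regVec v = algebraMap ℝ (Module.End ℝ (Finset (Fin d) → ℝ)) (cliffordForm d v) := by
  refine LinearMap.ext fun x => funext fun C => ?_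
  set F : Fin d → Fin d → ℝ := fun i j =>
    v i * v j * (sgn i C * sgn j C) * (if i ≤ j then -1 else 1) * x (C ∆ {i} ∆ {j}) with hF
  have h1 : (regVec v * regVec v) x C = ∑ i, ∑ j, F i j := by
    simp only [Module.End.mul_apply, regVec_apply, Finset.mul_sum, hF, sgn_symmDiff]
    refine Finset.sum_congr rfl fun i _ => Finset.sum_congr rfl fun j _ => ?_
    simp only [le_refl, if_true]
    ring
  have h2 : ∀ i j, F i j + F j i = if i = j then -2 * (v i * v i) * x C else 0 := by
    intro i j
    by_cases h : i = j
    · subst h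
      have := sgn_mul_self i C
      simp only [hF, this, symmDiff_symmDiff_cancel_right]
      simp
      ring
    · simp only [hF, h, if_false]
      rw [symmDiff_right_comm C {j} {i}]
      rcases lt_or_gt_of_ne h with h | h <;> simp [h.le, not_le.2 h] <;> ring
  have h3 : 2 * ∑ i, ∑ j, F i j = ∑ i, ∑ j, (F i j + F j i) := by
    simp only [Finset.sum_add_distrib]
    rw [Finset.sum_comm (f := fun i j => F j i)]
    ring
  rw [h1]
  simp only [h2, Finset.sum_ite_eq, Finset.mem_univ, if_true] at h3
  have h4 : 2 * ∑ i, ∑ j, F i j = 2 * (cliffordForm d v * x C) := by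
    rw [h3, cliffordForm, QuadraticMap.weightedSumSquares_apply, Finset.sum_mul, Finset.mul_sum]
    exact Finset.sum_congr rfl fun i _ => by simp; ring
  simpa [Module.algebraMap_end_apply] using mul_left_cancel₀ two_ne_zero h4

/-- The left regular representation of `ℝ_d` in coordinates. -/
noncomputable def reg : Cl d →ₐ[ℝ] Module.End ℝ (Finset (Fin d) → ℝ) :=
  CliffordAlgebra.lift (cliffordForm d) ⟨regVec, regVec_sq⟩

theorem reg_e (i : Fin d) (x : Finset (Fin d) → ℝ) (C : Finset (Fin d)) :
    reg (e i) x C = sgn i (C ∆ {i}) * x (C ∆ {i}) := by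
  rw [reg, e, CliffordAlgebra.lift_ι_apply]
  simp only [regVec_apply]
  rw [Finset.sum_eq_single i]
  · simp
  · intro j _ h; simp [h]
  · simp

theorem reg_list (l : List (Fin d)) (hl : l.SortedLT) :
    reg ((l.map e).prod) (Pi.single ∅ 1) = Pi.single l.toFinset 1 := by
  induction l with
  | nil => simp
  | cons a l ih =>
    have hl' := hl.pairwise
    rw [List.pairwise_cons] at hl'
    have ha : a ∉ l.toFinset := fun h => lt_irrefl _ (hl'.1 a (by simpa using h))
    rw [List.map_cons, List.prod_cons, map_mul, Module.End.mul_apply, ih hl'.2.sortedLT]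
    funext C
    have h1 : l.toFinset ∆ {a} = insert a l.toFinset := by
      ext x; by_cases x = a <;> simp_all [Finset.mem_symmDiff]
    rw [reg_e, List.toFinset_cons]
    by_cases hC : C ∆ {a} = l.toFinset
    · have hC' : C = insert a l.toFinset := by
        rw [← h1, ← hC, symmDiff_symmDiff_cancel_right]
      have : sgn a l.toFinset = 1 := Finset.prod_eq_one fun b hb =>
        if_neg (not_le.2 (hl'.1 b (by simpa using hb)))
      rw [hC, this, hC']
      simp
    · have hC' : C ≠ insert a l.toFinset := by
        rintro rfl
        apply hC
        rw [← h1, symmDiff_symmDiff_cancel_right]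
      simp [hC, hC']

theorem reg_eA (A : Finset (Fin d)) : reg (eA A) (Pi.single ∅ 1) = Pi.single A 1 := by
  rw [eA, reg_list _ (Finset.sortedLT_sort A), Finset.sort_toFinset]

theorem linearIndependent_eA : LinearIndependent ℝ (eA : Finset (Fin d) → Cl d) := by
  have h : LinearIndependent ℝ (fun A : Finset (Fin d) => (Pi.single A 1 : Finset (Fin d) → ℝ)) := by
    convert (Pi.basisFun ℝ (Finset (Fin d))).linearIndependent using 2 with A
    rw [Pi.basisFun_apply]
  let φ : Cl d →ₗ[ℝ] (Finset (Fin d) → ℝ) :=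
    (LinearMap.applyₗ (Pi.single ∅ 1 : Finset (Fin d) → ℝ)).comp reg.toLinearMap
  refine LinearIndependent.of_comp φ ?_
  convert h using 2 with A
  exact reg_eA A

theorem e_mul_list (i : Fin d) (l : List (Fin d)) (hl : l.SortedLT) :
    ∃ l' : List (Fin d), l'.SortedLT ∧ (∀ a ∈ l', a = i ∨ a ∈ l) ∧
      (e i * (l.map e).prod = (l'.map e).prod ∨ e i * (l.map e).prod = -(l'.map e).prod) := by
  induction l with
  | nil => exact ⟨[i], by simp [List.sortedLT_iff_pairwise], by simp, by simp⟩
  | cons a l ih =>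
    have hl' := hl.pairwise
    rw [List.pairwise_cons] at hl'
    rcases lt_trichotomy i a with h | h | h
    · refine ⟨i :: a :: l, ?_, by simp, by simp⟩
      rw [List.sortedLT_iff_pairwise, List.pairwise_cons]
      refine ⟨fun b hb => ?_, hl.pairwise⟩
      rcases List.mem_cons.1 hb with rfl | hb
      · exact h
      · exact h.trans (hl'.1 b hb)
    · subst h
      refine ⟨l, hl'.2.sortedLT, fun b hb => by simp [hb], Or.inr ?_⟩
      rw [List.map_cons, List.prod_cons, ← mul_assoc, e_mul_self, neg_one_mul]
    · obtain ⟨l', h1, h2, h3⟩ := ih hl'.2.sortedLT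
      refine ⟨a :: l', ?_, ?_, ?_⟩
      · rw [List.sortedLT_iff_pairwise, List.pairwise_cons]
        refine ⟨fun b hb => ?_, h1.pairwise⟩
        rcases h2 b hb with rfl | hb
        · exact h
        · exact hl'.1 b hb
      · intro b hb
        rcases List.mem_cons.1 hb with rfl | hb
        · simp
        · rcases h2 b hb with rfl | hb <;> simp_all
      · have key : e i * ((a :: l).map e).prod = -(e a * (e i * (l.map e).prod)) := by
          rw [List.map_cons, List.prod_cons, ← mul_assoc, e_anticomm h.ne', neg_mul, mul_assoc]
        rw [key, List.map_cons, List.prod_cons]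
        rcases h3 with h3 | h3 <;> rw [h3] <;> simp

theorem e_mul_mem_span (i : Fin d) (x : Cl d)
    (hx : x ∈ Submodule.span ℝ (Set.range (eA : Finset (Fin d) → Cl d))) :
    e i * x ∈ Submodule.span ℝ (Set.range (eA : Finset (Fin d) → Cl d)) := by
  induction hx using Submodule.span_induction with
  | mem x hx =>
    obtain ⟨A, rfl⟩ := hx
    obtain ⟨l', h1, -, h3⟩ := e_mul_list i _ (Finset.sortedLT_sort A)
    have h4 : (l'.map e).prod = eA l'.toFinset := by
      rw [eA]; congr 2
      refine (List.toFinset_sort (r := (· ≤ ·)) ?_).2 ?_ |>.symm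
      · exact h1.nodup
      · exact h1.sortedLE.pairwise
    have h5 : eA l'.toFinset ∈ Submodule.span ℝ (Set.range (eA : Finset (Fin d) → Cl d)) :=
      Submodule.subset_span ⟨_, rfl⟩
    rw [← h4] at h5
    rcases h3 with h3 | h3 <;> rw [eA, h3]
    · exact h5
    · exact Submodule.neg_mem _ h5
  | zero => simp
  | add x y _ _ hx hy => rw [mul_add]; exact Submodule.add_mem _ hx hy
  | smul c x _ hx => rw [mul_smul_comm]; exact Submodule.smul_mem _ _ hx

theorem span_eA : ⊤ ≤ Submodule.span ℝ (Set.range (eA : Finset (Fin d) → Cl d)) := by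
  intro x _
  induction x using CliffordAlgebra.left_induction with
  | algebraMap r =>
    rw [Algebra.algebraMap_eq_smul_one]
    exact Submodule.smul_mem _ _ (Submodule.subset_span ⟨∅, by simp [eA]⟩)
  | add x y hx hy => exact Submodule.add_mem _ (hx trivial) (hy trivial)
  | ι_mul x m hx =>
    have : CliffordAlgebra.ι (cliffordForm d) m = ∑ i, m i • e i := by
      simp only [e, ← map_smul, ← map_sum]
      congr 1
      exact pi_eq_sum_univ' m
    rw [this, Finset.sum_mul]
    refine Submodule.sum_mem _ fun i _ => ?_
    rw [smul_mul_assoc]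
    exact Submodule.smul_mem _ _ (e_mul_mem_span i x (hx trivial))

/-- The basis `(e_A)` of `ℝ_d`. -/
noncomputable def basis (d : ℕ) : Module.Basis (Finset (Fin d)) ℝ (Cl d) :=
  Module.Basis.mk linearIndependent_eA span_eA

theorem basis_apply (A : Finset (Fin d)) : basis d A = eA A := by simp [basis]


theorem list_mul_e (a : Fin d) (l : List (Fin d)) (h : a ∉ l) :
    (l.map e).prod * e a = (-1 : ℝ) ^ l.length • (e a * (l.map e).prod) := by
  induction l with
  | nil => simp
  | cons b l ih =>
    simp only [List.mem_cons, not_or] at h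
    rw [List.map_cons, List.prod_cons, mul_assoc, ih h.2, mul_smul_comm, ← mul_assoc,
      e_anticomm (Ne.symm h.1), neg_mul, mul_assoc, List.length_cons, pow_succ]
    simp

theorem star_list (l : List (Fin d)) (h : l.Nodup) :
    star (l.map e).prod = (-1 : ℝ) ^ (l.length * (l.length + 1) / 2) • (l.map e).prod := by
  induction l with
  | nil => simp
  | cons a l ih =>
    rw [List.nodup_cons] at h
    have h2 : (l.length + 1) * (l.length + 1 + 1) / 2
        = l.length * (l.length + 1) / 2 + (l.length + 1) := by
      have : (l.length + 1) * (l.length + 1 + 1)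
        = l.length * (l.length + 1) + (l.length + 1) * 2 := by ring
      rw [this, Nat.add_mul_div_right _ _ two_pos]
    have h3 : star (e a) = -e a := CliffordAlgebra.star_ι _
    rw [List.map_cons, List.prod_cons, star_mul, ih h.2, h3, mul_neg, smul_mul_assoc,
      list_mul_e a l h.1, List.length_cons, h2, pow_add, pow_succ, smul_smul, mul_neg_one,
      mul_neg, neg_smul]

/-- The star operation of `ℝ_d` is the Clifford conjugation
`Σ s_A e_A ↦ Σ (-1)^{|A|(|A|+1)/2} s_A e_A`. -/
theorem star_eA (A : Finset (Fin d)) :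
    star (eA A) = (-1 : ℝ) ^ (A.card * (A.card + 1) / 2) • eA A := by
  have := star_list (A.sort (· ≤ ·)) (Finset.sort_nodup A _)
  rwa [Finset.length_sort] at this

/-- The coordinate `s_A` of `s = Σ s_A e_A`. -/
noncomputable def coord (A : Finset (Fin d)) : Cl d →ₗ[ℝ] ℝ := (basis d).coord A

theorem coord_eq_reg (A : Finset (Fin d)) (s : Cl d) :
    coord A s = reg s (Pi.single ∅ 1) A := by
  let φ : Cl d →ₗ[ℝ] ℝ := (LinearMap.proj A).comp
    ((LinearMap.applyₗ (Pi.single ∅ 1 : Finset (Fin d) → ℝ)).comp reg.toLinearMap)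
  have h : coord A = φ := by
    refine (basis d).ext fun B => ?_
    have h1 : φ (basis d B) = reg (eA B) (Pi.single ∅ 1) A := by rw [basis_apply]; rfl
    rw [h1, reg_eA, coord, Module.Basis.coord_apply, Module.Basis.repr_self,
      Finsupp.single_apply, Pi.single_apply]
    simp [eq_comm]
  rw [h]; rfl

theorem reg_star (s : Cl d) : ∀ x y : Finset (Fin d) → ℝ,
    ∑ C, reg (star s) x C * y C = ∑ C, x C * reg s y C := by
  have hvec : ∀ (v : Fin d → ℝ) (x y : Finset (Fin d) → ℝ),
      ∑ C, regVec v x C * y C = -∑ C, x C * regVec v y C := by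
    intro v x y
    simp only [regVec_apply, Finset.sum_mul, Finset.mul_sum, ← Finset.sum_neg_distrib]
    rw [Finset.sum_comm, Finset.sum_comm (s := Finset.univ (α := Finset (Fin d)))]
    refine Finset.sum_congr rfl fun i _ => ?_
    refine Fintype.sum_equiv (Function.Involutive.toPerm (fun C : Finset (Fin d) => C ∆ {i})
      fun C => symmDiff_symmDiff_cancel_right _ _) _ _ fun C => ?_
    change _ = -(x (C ∆ {i}) * (v i * (sgn i (C ∆ {i} ∆ {i}) * y (C ∆ {i} ∆ {i}))))
    rw [symmDiff_symmDiff_cancel_right, sgn_symmDiff, if_pos le_rfl]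
    ring
  induction s using CliffordAlgebra.induction with
  | algebraMap r =>
    intro x y
    rw [CliffordAlgebra.star_algebraMap, AlgHom.commutes]
    refine Finset.sum_congr rfl fun C _ => ?_
    simp only [Module.algebraMap_end_apply, Pi.smul_apply, smul_eq_mul]
    ring
  | ι m =>
    intro x y
    have h : reg (CliffordAlgebra.ι (cliffordForm d) m) = regVec m :=
      CliffordAlgebra.lift_ι_apply _ _ _
    have h1 := hvec m x y
    rw [CliffordAlgebra.star_ι, map_neg, h]
    simp only [LinearMap.neg_apply, Pi.neg_apply, neg_mul, Finset.sum_neg_distrib, h1, neg_neg]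
  | mul a b ha hb =>
    intro x y
    rw [star_mul, map_mul, map_mul]
    simp only [Module.End.mul_apply]
    rw [hb, ha]
  | add a b ha hb =>
    intro x y
    rw [star_add, map_add, map_add]
    simp only [LinearMap.add_apply, Pi.add_apply, add_mul, mul_add, Finset.sum_add_distrib, ha, hb]

/-- The scalar part of `conj(s) t` is `Σ s_A t_A`. -/
theorem coord_star_mul (s t : Cl d) :
    coord ∅ (star s * t) = ∑ A, coord A s * coord A t := by
  have h := reg_star (star s) (Pi.single ∅ 1) (reg t (Pi.single ∅ 1))
  rw [star_star] at h
  simp only [coord_eq_reg, map_mul, Module.End.mul_apply, h]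
  rw [Finset.sum_eq_single ∅] <;> simp +contextual

/-- The coordinates `(s_A)` of `s = Σ s_A e_A`, as a vector of Euclidean space. -/
noncomputable def coords (d : ℕ) : Cl d ≃ₗ[ℝ] EuclideanSpace ℝ (Finset (Fin d)) :=
  (basis d).equivFun.trans (WithLp.linearEquiv 2 ℝ (Finset (Fin d) → ℝ)).symm

theorem coords_apply (s : Cl d) (A : Finset (Fin d)) : coords d s A = coord A s := rfl

/-- The absolute value `|s|² = Σ s_A²` of Clifford numbers. -/
noncomputable instance : NormedAddCommGroup (Cl d) :=
  NormedAddCommGroup.induced (Cl d) (EuclideanSpace ℝ (Finset (Fin d)))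
    (coords d : Cl d →ₗ[ℝ] EuclideanSpace ℝ (Finset (Fin d))) (coords d).injective

noncomputable instance : NormedSpace ℝ (Cl d) :=
  NormedSpace.induced ℝ (Cl d) (EuclideanSpace ℝ (Finset (Fin d)))
    (coords d : Cl d →ₗ[ℝ] EuclideanSpace ℝ (Finset (Fin d)))

theorem norm_sq (s : Cl d) : ‖s‖ ^ 2 = ∑ A, coord A s ^ 2 := by
  change ‖coords d s‖ ^ 2 = _
  simp [EuclideanSpace.norm_sq_eq, coords_apply]

end Cl

/-! ### Paravectors and slices -/

/-- Paravectors `s = (s_0, …, s_d) ∈ ℝ^{d+1}`, with the Euclidean norm `|s|`. -/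
abbrev Paravector (d : ℕ) : Type := EuclideanSpace ℝ (Fin (d + 1))

namespace Paravector

variable {d : ℕ}

/-- The paravector `s` as the Clifford number `s_0 + s_1 e_1 + ⋯ + s_d e_d`. -/
noncomputable def toCl (s : Paravector d) : Cl d :=
  algebraMap ℝ (Cl d) (s 0) + ∑ i : Fin d, s i.succ • Cl.e i

/-- The real number `x` as a paravector. -/
noncomputable def ofReal (x : ℝ) : Paravector d := EuclideanSpace.single 0 x

/-- The imaginary part `s_1 e_1 + ⋯ + s_d e_d`. -/
noncomputable def im (s : Paravector d) : Paravector d := s - ofReal (s 0)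

/-- The conjugate `s_0 - s_1 e_1 - ⋯ - s_d e_d`. -/
noncomputable def conj (s : Paravector d) : Paravector d := ofReal (s 0) - im s

/-- The sphere `𝕊` of imaginary units. -/
def imSphere (d : ℕ) : Set (Paravector d) := {J | J 0 = 0 ∧ ‖J‖ = 1}

/-- The point `x + J y` of the plane `ℂ_J`, where `z = x + i y`. -/
noncomputable def slice (J : Paravector d) (z : ℂ) : Paravector d := ofReal z.re + z.im • J

/-- `U` is axially symmetric: with `s` it contains the sphere `[s] = {s_0 + J |Im s| : J ∈ 𝕊}`. -/
def AxiallySymmetric (U : Set (Paravector d)) : Prop :=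
  ∀ s ∈ U, ∀ J ∈ imSphere d, ofReal (s 0) + ‖im s‖ • J ∈ U

/-- The set `{(x, y) : x + 𝕊 y ⊆ U}`, with `ℝ²` identified with `ℂ`. -/
def planeSet (U : Set (Paravector d)) : Set ℂ := {z | ∀ J ∈ imSphere d, slice J z ∈ U}

/-- `f_0, f_1` are continuously differentiable and satisfy the compatibility conditions and
the Cauchy-Riemann equations on `planeSet U`. -/
structure IsSlicePair (U : Set (Paravector d)) (f₀ f₁ : ℂ → Cl d) : Prop where
  contDiffOn₀ : ContDiffOn ℝ 1 f₀ (planeSet U)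
  contDiffOn₁ : ContDiffOn ℝ 1 f₁ (planeSet U)
  even : ∀ z ∈ planeSet U, f₀ (starRingEnd ℂ z) = f₀ z
  odd : ∀ z ∈ planeSet U, f₁ (starRingEnd ℂ z) = -f₁ z
  cauchyRiemann₁ : ∀ z ∈ planeSet U, fderiv ℝ f₀ z 1 = fderiv ℝ f₁ z Complex.I
  cauchyRiemann₂ : ∀ z ∈ planeSet U, fderiv ℝ f₀ z Complex.I = -fderiv ℝ f₁ z 1

/-- Left slice hyperholomorphic functions on `U`. -/
def LeftSliceHyperholomorphic (U : Set (Paravector d)) (f : Paravector d → Cl d) : Prop :=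
  ∃ f₀ f₁ : ℂ → Cl d, IsSlicePair U f₀ f₁ ∧
    ∀ z ∈ planeSet U, ∀ J ∈ imSphere d, f (slice J z) = f₀ z + toCl J * f₁ z

/-- Right slice hyperholomorphic functions on `U`. -/
def RightSliceHyperholomorphic (U : Set (Paravector d)) (f : Paravector d → Cl d) : Prop :=
  ∃ f₀ f₁ : ℂ → Cl d, IsSlicePair U f₀ f₁ ∧
    ∀ z ∈ planeSet U, ∀ J ∈ imSphere d, f (slice J z) = f₀ z + f₁ z * toCl J

/-- Intrinsic functions on `U`: slice hyperholomorphic with real valued `f_0`, `f_1`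
(for such `f_0`, `f_1` left and right slice hyperholomorphicity are the same). -/
def Intrinsic (U : Set (Paravector d)) (f : Paravector d → Cl d) : Prop :=
  ∃ f₀ f₁ : ℂ → Cl d, IsSlicePair U f₀ f₁ ∧
    (∀ z ∈ planeSet U, f₀ z ∈ Set.range (algebraMap ℝ (Cl d)) ∧
      f₁ z ∈ Set.range (algebraMap ℝ (Cl d))) ∧
    ∀ z ∈ planeSet U, ∀ J ∈ imSphere d, f (slice J z) = f₀ z + toCl J * f₁ z

/-- The function `f^#`, sending `s` to the conjugate of `f (conj s)`. -/
noncomputable def sharp (f : Paravector d → Cl d) : Paravector d → Cl d :=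
  fun s => star (f (conj s))

end Paravector

/-! ### Hilbert modules over `ℝ_d` and their bounded operators -/

/-- The Clifford module `V = {Σ v_A ⊗ e_A : v_A ∈ H}` over a real Hilbert space `H`: the element
`Σ v_A ⊗ e_A` is given by its components `v_A`, and the norm is `‖v‖² = Σ ‖v_A‖²`. -/
abbrev CliffordModule (d : ℕ) (H : Type*) : Type _ := PiLp 2 (fun _ : Finset (Fin d) => H)

namespace CliffordModule

variable {d : ℕ} {H : Type*} [NormedAddCommGroup H] [InnerProductSpace ℝ H]

/-- Left multiplication `v ↦ s v = Σ_{A,B} s_B v_A ⊗ e_B e_A`; the `C`-component of `s v` is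
`Σ_A (s e_A)_C v_A`. -/
noncomputable def leftMul (s : Cl d) : CliffordModule d H →L[ℝ] CliffordModule d H :=
  (PiLp.continuousLinearEquiv 2 ℝ (fun _ : Finset (Fin d) => H)).symm.toContinuousLinearMap ∘L
    ContinuousLinearMap.pi fun C =>
      ∑ A, Cl.coord C (s * Cl.eA A) • PiLp.proj 2 (fun _ : Finset (Fin d) => H) A

/-- Right multiplication `v ↦ v s = Σ_{A,B} v_A s_B ⊗ e_A e_B`; the `C`-component of `v s` is
`Σ_A (e_A s)_C v_A`. -/
noncomputable def rightMul (s : Cl d) : CliffordModule d H →L[ℝ] CliffordModule d H :=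
  (PiLp.continuousLinearEquiv 2 ℝ (fun _ : Finset (Fin d) => H)).symm.toContinuousLinearMap ∘L
    ContinuousLinearMap.pi fun C =>
      ∑ A, Cl.coord C (Cl.eA A * s) • PiLp.proj 2 (fun _ : Finset (Fin d) => H) A

theorem leftMul_apply (s : Cl d) (v : CliffordModule d H) (C : Finset (Fin d)) :
    leftMul s v C = ∑ A, Cl.coord C (s * Cl.eA A) • v A := by
  simp [leftMul]

theorem rightMul_apply (s : Cl d) (v : CliffordModule d H) (C : Finset (Fin d)) :
    rightMul s v C = ∑ A, Cl.coord C (Cl.eA A * s) • v A := by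
  simp [rightMul]

/-- The `ℝ_d`-valued inner product `⟨v, w⟩ = Σ_{A,B} ⟨v_A, w_B⟩ conj(e_A) e_B`. -/
noncomputable def cliffordInner (v w : CliffordModule d H) : Cl d :=
  ∑ A, ∑ B, (inner ℝ (v A) (w B)) • (star (Cl.eA A) * Cl.eA B)

/-- The scalar part of `⟨v, w⟩` is the inner product of the real Hilbert space `V`, so that the
adjoint of an operator with respect to `Sc ⟨v, w⟩` is its Hilbert space adjoint. -/
theorem scalar_cliffordInner (v w : CliffordModule d H) :
    Cl.coord ∅ (cliffordInner v w) = inner ℝ v w := by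
  have h : ∀ A B C : Finset (Fin d), Cl.coord C (Cl.eA A) = if A = C then 1 else 0 := by
    intro A _ C
    rw [Cl.coord, ← Cl.basis_apply, Module.Basis.coord_apply, Module.Basis.repr_self,
      Finsupp.single_apply]
  simp only [cliffordInner, map_sum, map_smul, Cl.coord_star_mul, smul_eq_mul, PiLp.inner_apply]
  refine Finset.sum_congr rfl fun A _ => ?_
  simp [h _ ∅]

/-- The bounded operator `T` is right-linear, that is `T ∈ 𝓑(V)`. -/
def IsRightLinear (T : CliffordModule d H →L[ℝ] CliffordModule d H) : Prop :=
  ∀ (s : Cl d) (v : CliffordModule d H), T (rightMul s v) = rightMul s (T v)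

/-- The operator `Q_s[T] = T² - 2 s_0 T + |s|²`. -/
noncomputable def Q (s : Paravector d) (T : CliffordModule d H →L[ℝ] CliffordModule d H) :
    CliffordModule d H →L[ℝ] CliffordModule d H :=
  T * T - (2 * s 0) • T + (‖s‖ ^ 2) • 1

/-- The `S`-resolvent set: `Q_s[T]` has an inverse in `𝓑(V)`. -/
def sResolventSet (T : CliffordModule d H →L[ℝ] CliffordModule d H) : Set (Paravector d) :=
  {s | ∃ R : CliffordModule d H →L[ℝ] CliffordModule d H,
    IsRightLinear R ∧ R * Q s T = 1 ∧ Q s T * R = 1}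

/-- The `S`-spectrum. -/
def sSpectrum (T : CliffordModule d H →L[ℝ] CliffordModule d H) : Set (Paravector d) :=
  (sResolventSet T)ᶜ

/-- The left `S`-resolvent operator `Q_s[T]⁻¹ conj(s) - T Q_s[T]⁻¹`. -/
noncomputable def leftResolvent (s : Paravector d)
    (T : CliffordModule d H →L[ℝ] CliffordModule d H) :
    CliffordModule d H →L[ℝ] CliffordModule d H :=
  Ring.inverse (Q s T) * leftMul s.conj.toCl - T * Ring.inverse (Q s T)

/-- The right `S`-resolvent operator `(conj(s) - T) Q_s[T]⁻¹`. -/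
noncomputable def rightResolvent (s : Paravector d)
    (T : CliffordModule d H →L[ℝ] CliffordModule d H) :
    CliffordModule d H →L[ℝ] CliffordModule d H :=
  (leftMul s.conj.toCl - T) * Ring.inverse (Q s T)

end CliffordModule

/-! ### The bounded `S`-functional calculus -/

open Paravector in
/-- The data on which the `S`-functional calculus integrals depend: an imaginary unit `J` and an
axially symmetric open set `U` with `K ⊆ U ⊆ closure U ⊆ U'`, whose boundary in the plane `ℂ_J`
(identified with `ℂ`) consists of finitely many `C¹` arcs that join up to closed curves and that
are positively oriented: they wind once around the points of `U`, and do not wind around the points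
outside `closure U`. -/
structure SliceContour {d : ℕ} (K U' : Set (Paravector d)) where
  /-- the imaginary unit -/
  J : Paravector d
  J_mem : J ∈ imSphere d
  /-- the open set around `K` -/
  U : Set (Paravector d)
  isOpen : IsOpen U
  axiallySymmetric : AxiallySymmetric U
  subset_U : K ⊆ U
  closure_subset : closure U ⊆ U'
  /-- the number of boundary arcs -/
  n : ℕ
  /-- the boundary arcs, parametrized over `[0, 1]` -/
  γ : Fin n → ℝ → ℂ
  contDiffOn : ∀ k, ContDiffOn ℝ 1 (γ k) (Set.Icc 0 1)
  closed : (Finset.univ.val.map fun k => γ k 0) = Finset.univ.val.map fun k => γ k 1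
  image_eq : (⋃ k, γ k '' Set.Icc 0 1) = {z | slice J z ∈ frontier U}
  winding_inside : ∀ w : ℂ, slice J w ∈ U →
    ∑ k, ∫ t in (0 : ℝ)..1, derivWithin (γ k) (Set.Icc 0 1) t / (γ k t - w)
      = 2 * Real.pi * Complex.I
  winding_outside : ∀ w : ℂ, slice J w ∉ closure U →
    ∑ k, ∫ t in (0 : ℝ)..1, derivWithin (γ k) (Set.Icc 0 1) t / (γ k t - w) = 0

namespace SliceContour

open Paravector CliffordModule

variable {d : ℕ} {K U' : Set (Paravector d)} {H : Type*} [NormedAddCommGroup H]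
  [InnerProductSpace ℝ H]

/-- The point `s` of the `k`-th boundary arc at the parameter `t`. -/
noncomputable def pt (c : SliceContour K U') (k : Fin c.n) (t : ℝ) : Paravector d :=
  slice c.J (c.γ k t)

/-- The element `ds_J = ds (-J)` of the `k`-th boundary arc at the parameter `t`. -/
noncomputable def ds (c : SliceContour K U') (k : Fin c.n) (t : ℝ) : Cl d :=
  toCl (slice c.J (derivWithin (c.γ k) (Set.Icc 0 1) t)) * -toCl c.J

/-- The left `S`-functional calculus `1/(2π) ∫_{∂U ∩ ℂ_J} S_L⁻¹(s, T) ds_J f(s)`. -/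
noncomputable def left (c : SliceContour K U') (f : Paravector d → Cl d)
    (T : CliffordModule d H →L[ℝ] CliffordModule d H) :
    CliffordModule d H →L[ℝ] CliffordModule d H :=
  (1 / (2 * Real.pi)) • ∑ k, ∫ t in (0 : ℝ)..1,
    leftResolvent (c.pt k t) T * leftMul (c.ds k t * f (c.pt k t))

/-- The right `S`-functional calculus `1/(2π) ∫_{∂U ∩ ℂ_J} f(s) ds_J S_R⁻¹(s, T)`. -/
noncomputable def right (c : SliceContour K U') (f : Paravector d → Cl d)
    (T : CliffordModule d H →L[ℝ] CliffordModule d H) :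
    CliffordModule d H →L[ℝ] CliffordModule d H :=
  (1 / (2 * Real.pi)) • ∑ k, ∫ t in (0 : ℝ)..1,
    leftMul (f (c.pt k t) * c.ds k t) * rightResolvent (c.pt k t) T

end SliceContour

/-!
The idea is to reduce both sides to intrinsic functions, for which the order of the factors does
not matter. In the basis `e_A`, a left slice hyperholomorphic function is `f = ∑ F_A e_A` with
intrinsic functions `F_A`, that is, with holomorphic `F_A : ℂ → ℂ` such that
`F_A(conj z) = conj (F_A z)`, transplanted to every plane `ℂ_J`. Then `f^# = ∑ conj(e_A) F_A` is
right slice hyperholomorphic. The left calculus gives `f(T^*) = ∑ F_A(T^*) e_A`, and the right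
calculus gives `f^#(T) = ∑ conj(e_A) F_A(T)` (`SliceContour.left_eq_sum`,
`SliceContour.right_eq_sum`). Since the adjoint of left multiplication by `s` is left multiplication
by `conj(s)` (`CliffordModule.adjoint_leftMul`), the claim follows from `F(T^*) = F(T)^*` for
intrinsic `F` (`SliceContour.arcIntegral_star`).

For intrinsic `F`, the calculus is the integral of the real part of `-i dz F(z) (conj(z) - T) Q_z⁻¹`
in the complexification of the algebra of bounded operators (`SliceContour.arcIntegral`), plus `J`
times the integral of the imaginary part. The real part visibly commutes with the adjoint if both
sides use the same contour, because `Q_z` has real coefficients. So two facts remain: the integral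
of the imaginary part vanishes, and the integral of the real part does not depend on the contour,
which includes the imaginary unit `J`.

Both facts are tested with real functionals `ℓ`, which turn the integrals into complex ones of the
function `F * planeResolvent ℓ T`. This function is holomorphic off the spectrum and commutes with
complex conjugation. Given two contours, the first one together with the complex conjugate of the
second one has winding number zero around the spectrum and around the complement of the domain of
`f`, as conjugation reverses orientation. A homological Cauchy theorem
(`sum_integral_mul_eq_zero_of_cauchyTransform_eq_zero`) then says that the first integral is minus
the conjugate of the second one. For two equal contours the integral is therefore purely imaginary,
which is the first fact, and then it is the same for any two contours, which is the second.
-/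

section

open Set Filter Topology MeasureTheory Paravector CliffordModule

/-! ### Cauchy's theorem for cycles -/

/-- Holomorphic dependence of an integral on a parameter. Only a bound on the integrand is
needed: it bounds the derivative on a smaller disc by the Cauchy estimate. -/
theorem differentiableAt_intervalIntegral_of_forall_norm_le {G : ℂ → ℝ → ℂ} {z₀ : ℂ} {r M : ℝ}
    (hr : 0 < r) (hc : ∀ z ∈ Metric.ball z₀ r, ContinuousOn (G z) (Icc 0 1))
    (hd : ∀ t ∈ Icc (0 : ℝ) 1, DifferentiableOn ℂ (fun z => G z t) (Metric.ball z₀ r))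
    (hb : ∀ z ∈ Metric.ball z₀ r, ∀ t ∈ Icc (0 : ℝ) 1, ‖G z t‖ ≤ M) :
    DifferentiableAt ℂ (fun z => ∫ t in (0 : ℝ)..1, G z t) z₀ := by
  have hsub : uIoc (0 : ℝ) 1 ⊆ Icc 0 1 := by
    rw [uIoc_of_le zero_le_one]; exact Ioc_subset_Icc_self
  have hmeas : ∀ z ∈ Metric.ball z₀ r,
      AEStronglyMeasurable (G z) (volume.restrict (uIoc (0 : ℝ) 1)) := fun z hz =>
    ((hc z hz).mono hsub).aestronglyMeasurable measurableSet_uIoc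
  have hz₀ : z₀ ∈ Metric.ball z₀ r := Metric.mem_ball_self hr
  have hdiff : ∀ t ∈ Icc (0 : ℝ) 1, ∀ z ∈ Metric.ball z₀ r,
      HasDerivAt (fun z => G z t) (deriv (fun z => G z t) z) z := fun t ht z hz =>
    ((hd t ht).differentiableAt (Metric.isOpen_ball.mem_nhds hz)).hasDerivAt
  refine (intervalIntegral.hasDerivAt_integral_of_dominated_loc_of_deriv_le
    (F' := fun z t => deriv (fun z => G z t) z) (bound := fun _ => M / (r / 4))
    (Metric.ball_mem_nhds z₀ (half_pos hr)) ?_ ?_ ?_ ?_ ?_ ?_).2.differentiableAt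
  · exact eventually_of_mem (Metric.isOpen_ball.mem_nhds hz₀) hmeas
  · exact ((hc z₀ hz₀).mono (by rw [uIcc_of_le zero_le_one])).intervalIntegrable
  · -- the derivative is the pointwise limit of a sequence of difference quotients
    have hε : Tendsto (fun n : ℕ => ((r / (n + 2) : ℝ) : ℂ)) atTop (𝓝 0) := by
      have : Tendsto (fun n : ℕ => r / ((n : ℝ) + 2)) atTop (𝓝 0) :=
        Tendsto.div_atTop tendsto_const_nhds
          (tendsto_atTop_add_const_right _ _ tendsto_natCast_atTop_atTop)
      exact_mod_cast (Complex.continuous_ofReal.tendsto 0).comp this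
    have hpos : ∀ n : ℕ, 0 < r / ((n : ℝ) + 2) := fun n => by positivity
    refine aestronglyMeasurable_of_tendsto_ae atTop
      (f := fun (n : ℕ) t => ((r / (n + 2) : ℝ) : ℂ)⁻¹ •
        (G (z₀ + ((r / (n + 2) : ℝ) : ℂ)) t - G z₀ t)) (fun n => ?_) ?_
    · refine ((hmeas _ ?_).sub (hmeas _ hz₀)).const_smul (((r / (n + 2) : ℝ) : ℂ)⁻¹)
      rw [Metric.mem_ball, dist_eq_norm, add_sub_cancel_left, Complex.norm_real,
        Real.norm_of_nonneg (hpos n).le]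
      exact div_lt_self hr (by linarith [(Nat.cast_nonneg n : (0 : ℝ) ≤ n)])
    · refine (ae_restrict_iff' measurableSet_uIoc).2 (ae_of_all _ fun t ht => ?_)
      refine (hdiff t (hsub ht) z₀ hz₀).tendsto_slope_zero.comp
        (tendsto_nhdsWithin_iff.2 ⟨hε, Eventually.of_forall fun n => ?_⟩)
      exact Complex.ofReal_ne_zero.2 (hpos n).ne'
  · refine ae_of_all _ fun t ht z hz => ?_
    have hcl : Metric.closedBall z (r / 4) ⊆ Metric.ball z₀ r := by
      intro w hw
      have h1 := Metric.mem_closedBall.1 hw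
      have h2 := Metric.mem_ball.1 hz
      have h3 := dist_triangle w z z₀
      exact Metric.mem_ball.2 (by linarith)
    refine Complex.norm_deriv_le_of_forall_mem_sphere_norm_le (by positivity) ?_
      fun w hw => hb w (hcl (Metric.sphere_subset_closedBall hw)) t (hsub ht)
    exact DifferentiableOn.diffContOnCl (((hd t (hsub ht)).mono hcl).mono
      Metric.closure_ball_subset_closedBall)
  · exact intervalIntegrable_const
  · exact ae_of_all _ fun t ht z hz => hdiff t (hsub ht) z
      (Metric.ball_subset_ball (half_le_self hr.le) hz)

theorem dslope_comm (f : ℂ → ℂ) (a b : ℂ) : dslope f a b = dslope f b a := by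
  rcases eq_or_ne a b with rfl | h
  · rfl
  · rw [dslope_of_ne f h.symm, dslope_of_ne f h, slope_comm]

/-- The difference quotients of a holomorphic function are locally bounded in one variable,
uniformly for the other variable in a compact set: by the mean value inequality for nearby points,
and by the triangle inequality for distant ones. -/
theorem exists_norm_dslope_le {f : ℂ → ℂ} {Ω K : Set ℂ} (hΩ : IsOpen Ω)
    (hf : DifferentiableOn ℂ f Ω) (hK : IsCompact K) (hKΩ : K ⊆ Ω) {z₀ : ℂ} (hz₀ : z₀ ∈ Ω) :
    ∃ r > 0, Metric.ball z₀ r ⊆ Ω ∧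
      ∃ M, ∀ z ∈ Metric.ball z₀ r, ∀ w ∈ K, ‖dslope f w z‖ ≤ M := by
  obtain ⟨R, hR, hRΩ⟩ := Metric.isOpen_iff.1 hΩ z₀ hz₀
  have hcl : Metric.closedBall z₀ (R / 2) ⊆ Ω :=
    (Metric.closedBall_subset_ball (by linarith)).trans hRΩ
  obtain ⟨M₁, hM₁⟩ := (isCompact_closedBall z₀ (R / 2)).exists_bound_of_continuousOn
    ((hf.deriv hΩ).continuousOn.mono hcl)
  obtain ⟨M₂, hM₂⟩ := ((isCompact_closedBall z₀ (R / 2)).union hK).exists_bound_of_continuousOn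
    (hf.continuousOn.mono (union_subset hcl hKΩ))
  refine ⟨R / 4, by positivity, (Metric.ball_subset_ball (by linarith)).trans hRΩ,
    max M₁ ((M₂ + M₂) / (R / 4)), fun z hz w hw => ?_⟩
  have hz' : z ∈ Metric.closedBall z₀ (R / 2) :=
    Metric.ball_subset_closedBall (Metric.ball_subset_ball (by linarith) hz)
  by_cases hwz : w ∈ Metric.closedBall z₀ (R / 2)
  · refine le_max_of_le_left ?_
    rcases eq_or_ne z w with rfl | hne
    · rw [dslope_same]; exact hM₁ z hz'
    · rw [dslope_of_ne f hne, slope_def_module, norm_smul, norm_inv]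
      have h := Convex.norm_image_sub_le_of_norm_deriv_le (f := f)
        (fun x hx => hf.differentiableAt (hΩ.mem_nhds (hcl hx))) hM₁
        (convex_closedBall z₀ (R / 2)) hwz hz'
      have hpos : 0 < ‖z - w‖ := norm_pos_iff.2 (sub_ne_zero.2 hne)
      rwa [inv_mul_le_iff₀ hpos, mul_comm]
  · refine le_max_of_le_right ?_
    rw [Metric.mem_closedBall, not_le] at hwz
    have hzz := Metric.mem_ball.1 hz
    have hdist : R / 4 ≤ ‖z - w‖ := by
      have := dist_triangle w z z₀
      rw [← dist_eq_norm, dist_comm]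
      linarith
    have hne : z ≠ w := by
      rintro rfl
      rw [sub_self, norm_zero] at hdist
      linarith
    rw [dslope_of_ne f hne, slope_def_module, norm_smul, norm_inv, inv_mul_eq_div]
    refine div_le_div₀ ?_ ?_ (by positivity) hdist
    · linarith [(norm_nonneg _).trans (hM₂ w (Or.inr hw))]
    · exact (norm_sub_le _ _).trans (add_le_add (hM₂ z (Or.inl hz')) (hM₂ w (Or.inr hw)))

theorem tendsto_intervalIntegral_div_sub_cocompact {γ ψ : ℝ → ℂ}
    (hγ : ContinuousOn γ (Icc 0 1)) (hψ : ContinuousOn ψ (Icc 0 1)) :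
    Tendsto (fun z => ∫ t in (0 : ℝ)..1, ψ t / (γ t - z)) (cocompact ℂ) (𝓝 0) := by
  obtain ⟨C, hC⟩ := isCompact_Icc.exists_bound_of_continuousOn hψ
  obtain ⟨R, hR⟩ := isCompact_Icc.exists_bound_of_continuousOn hγ
  have hlim : Tendsto (fun z : ℂ => C / (‖z‖ - R)) (cocompact ℂ) (𝓝 0) :=
    tendsto_const_nhds.div_atTop
      (tendsto_atTop_add_const_right _ (-R) (tendsto_norm_cocompact_atTop (E := ℂ)))
  refine squeeze_zero_norm' ?_ hlim
  filter_upwards [(tendsto_norm_cocompact_atTop (E := ℂ)).eventually_gt_atTop R] with z hz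
  have h := intervalIntegral.norm_integral_le_of_norm_le_const (a := (0 : ℝ)) (b := 1)
    (f := fun t => ψ t / (γ t - z)) (C := C / (‖z‖ - R)) fun t ht => ?_
  · simpa using h
  · rw [uIoc_of_le zero_le_one] at ht
    have ht' := Ioc_subset_Icc_self ht
    rw [norm_div]
    refine div_le_div₀ ((norm_nonneg _).trans (hC t ht')) (hC t ht') (by linarith) ?_
    rw [norm_sub_rev]
    linarith [norm_sub_norm_le z (γ t), hR t ht']

/-- A homological form of Cauchy's theorem, for the complex measure that is the sum of the images
of `φ k t dt` under `γ k`: if its Cauchy transform vanishes on an open set `Ω₁` that contains the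
complement of `Ω`, then it annihilates the holomorphic functions on `Ω`. This is Dixon's argument.
With `F w = (w - a) f w`, the function `∑ ∫ φ (F γ - F z) / (γ - z)` on `Ω` and the Cauchy transform
`∑ ∫ φ F γ / (γ - z)` on `Ω₁` glue to an entire function that vanishes at infinity, hence
everywhere; its value at `a` is `∑ ∫ φ f γ`. -/
theorem sum_integral_mul_eq_zero_of_cauchyTransform_eq_zero {ι : Type*} [Fintype ι]
    {γ φ : ι → ℝ → ℂ} (hγ : ∀ k, ContinuousOn (γ k) (Icc 0 1))
    (hφ : ∀ k, ContinuousOn (φ k) (Icc 0 1)) {Ω Ω₁ : Set ℂ} (hΩ : IsOpen Ω) (hΩ₁ : IsOpen Ω₁)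
    (hcov : ∀ z, z ∈ Ω ∨ z ∈ Ω₁) (hγΩ : ∀ k, ∀ t ∈ Icc (0 : ℝ) 1, γ k t ∈ Ω)
    (hγΩ₁ : ∀ k, ∀ t ∈ Icc (0 : ℝ) 1, γ k t ∉ Ω₁)
    (hbdd : ∀ᶠ z in cocompact ℂ, z ∈ Ω₁)
    (hwind : ∀ w ∈ Ω₁, ∑ k, ∫ t in (0 : ℝ)..1, φ k t / (γ k t - w) = 0)
    {f : ℂ → ℂ} (hf : DifferentiableOn ℂ f Ω) :
    ∑ k, ∫ t in (0 : ℝ)..1, φ k t * f (γ k t) = 0 := by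
  rcases isEmpty_or_nonempty ι with hι | ⟨⟨k₀⟩⟩
  · simp
  -- any point of `Ω` serves; it may lie on the arcs
  obtain ⟨a, haΩ⟩ : ∃ a, a ∈ Ω := ⟨_, hγΩ k₀ 0 (by simp)⟩
  have hI : uIcc (0 : ℝ) 1 = Icc 0 1 := uIcc_of_le zero_le_one
  set F : ℂ → ℂ := fun w => (w - a) * f w with hFdef
  have hF : DifferentiableOn ℂ F Ω := ((differentiableOn_id.sub_const a).mul hf)
  have hFγ : ∀ k, ContinuousOn (fun t => F (γ k t)) (Icc 0 1) := fun k =>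
    hF.continuousOn.comp (hγ k) (hγΩ k)
  -- all arcs lie in a compact subset of `Ω`
  set K : Set ℂ := ⋃ k, γ k '' Icc 0 1
  have hKc : IsCompact K := isCompact_iUnion fun k => isCompact_Icc.image_of_continuousOn (hγ k)
  have hKΩ : K ⊆ Ω := iUnion_subset fun k => image_subset_iff.2 (hγΩ k)
  have hmemK : ∀ k, ∀ t ∈ Icc (0 : ℝ) 1, γ k t ∈ K := fun k t ht =>
    mem_iUnion.2 ⟨k, mem_image_of_mem _ ht⟩
  set h₀ : ℂ → ℂ := fun z => ∑ k, ∫ t in (0 : ℝ)..1, φ k t * dslope F z (γ k t) with hh₀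
  set h₁ : ℂ → ℂ := fun z => ∑ k, ∫ t in (0 : ℝ)..1, φ k t * F (γ k t) / (γ k t - z) with hh₁
  have hcauchy : ∀ z ∈ Ω₁, ∀ k, ∀ ψ : ℝ → ℂ, ContinuousOn ψ (Icc 0 1) →
      ContinuousOn (fun t => ψ t / (γ k t - z)) (Icc 0 1) := fun z hz k ψ hψ =>
    hψ.div ((hγ k).sub continuousOn_const) fun t ht h0 =>
      hγΩ₁ k t ht (by rwa [sub_eq_zero.1 h0])
  have hagree : ∀ z ∈ Ω, z ∈ Ω₁ → h₀ z = h₁ z := by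
    intro z _ hz₁
    have h1 : h₀ z = h₁ z - F z * ∑ k, ∫ t in (0 : ℝ)..1, φ k t / (γ k t - z) := by
      simp only [hh₀, hh₁, Finset.mul_sum, ← Finset.sum_sub_distrib,
        ← intervalIntegral.integral_const_mul]
      refine Finset.sum_congr rfl fun k _ => ?_
      rw [← intervalIntegral.integral_sub]
      · refine intervalIntegral.integral_congr fun t ht => ?_
        rw [hI] at ht
        have hne : γ k t ≠ z := fun h => hγΩ₁ k t ht (h ▸ hz₁)
        have hne' := sub_ne_zero.2 hne
        simp only [dslope_of_ne F hne, slope_def_field]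
        field_simp
      · exact (hI ▸ hcauchy z hz₁ k _ ((hφ k).mul (hFγ k))).intervalIntegrable
      · exact ((hI ▸ hcauchy z hz₁ k _ (hφ k)).const_smul (F z)).intervalIntegrable
    rw [h1, hwind z hz₁, mul_zero, sub_zero]
  have hd₀ : ∀ z ∈ Ω, DifferentiableAt ℂ h₀ z := by
    intro z hz
    obtain ⟨r, hr, hrΩ, M, hM⟩ := exists_norm_dslope_le hΩ hF hKc hKΩ hz
    refine DifferentiableAt.fun_sum fun k _ => ?_
    obtain ⟨C, hC⟩ := isCompact_Icc.exists_bound_of_continuousOn (hφ k)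
    refine differentiableAt_intervalIntegral_of_forall_norm_le (r := r) (M := C * M) hr
      (fun x hx => (hφ k).mul ?_) (fun t ht => DifferentiableOn.const_mul ?_ _) fun x hx t ht => ?_
    · exact ((Complex.differentiableOn_dslope (hΩ.mem_nhds (hrΩ hx))).2 hF).continuousOn.comp
        (hγ k) (hγΩ k)
    · simp only [dslope_comm F _ (γ k t)]
      exact ((Complex.differentiableOn_dslope (hΩ.mem_nhds (hγΩ k t ht))).2 hF).mono hrΩ
    · rw [norm_mul, dslope_comm]
      exact mul_le_mul (hC t ht) (hM x hx _ (hmemK k t ht)) (norm_nonneg _)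
        ((norm_nonneg _).trans (hC t ht))
  have hd₁ : ∀ z ∈ Ω₁, DifferentiableAt ℂ h₁ z := by
    intro z hz
    obtain ⟨R, hR, hRΩ⟩ := Metric.isOpen_iff.1 hΩ₁ z hz
    refine DifferentiableAt.fun_sum fun k _ => ?_
    obtain ⟨C, hC⟩ := isCompact_Icc.exists_bound_of_continuousOn ((hφ k).mul (hFγ k))
    have hsub : Metric.ball z (R / 2) ⊆ Ω₁ := (Metric.ball_subset_ball (by linarith)).trans hRΩ
    refine differentiableAt_intervalIntegral_of_forall_norm_le (r := R / 2) (M := C / (R / 2))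
      (by positivity) (fun x hx => hcauchy x (hsub hx) k _ ((hφ k).mul (hFγ k)))
      (fun t ht => ?_) fun x hx t ht => ?_
    · refine (differentiableOn_const _).div ((differentiableOn_const _).sub differentiableOn_id)
        fun x hx h0 => hγΩ₁ k t ht ?_
      rw [sub_eq_zero.1 h0]; exact hsub hx
    · have h1 : R ≤ dist (γ k t) z := by
        by_contra hlt
        exact hγΩ₁ k t ht (hRΩ (Metric.mem_ball.2 (not_le.1 hlt)))
      have h2 := dist_triangle (γ k t) x z
      have h3 := Metric.mem_ball.1 hx
      rw [norm_div]
      refine div_le_div₀ ((norm_nonneg _).trans (hC t ht)) (hC t ht) (by positivity) ?_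
      rw [← dist_eq_norm]; linarith
  classical
  set h : ℂ → ℂ := fun z => if z ∈ Ω then h₀ z else h₁ z with hh
  have hΩeq : ∀ z ∈ Ω, h z = h₀ z := fun z hz => if_pos hz
  have hΩ₁eq : ∀ z ∈ Ω₁, h z = h₁ z := fun z hz => by
    by_cases hzΩ : z ∈ Ω
    · rw [hΩeq z hzΩ, hagree z hzΩ hz]
    · exact if_neg hzΩ
  have hent : Differentiable ℂ h := by
    intro z
    rcases hcov z with hz | hz
    · exact (hd₀ z hz).congr_of_eventuallyEq (eventually_of_mem (hΩ.mem_nhds hz) hΩeq)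
    · exact (hd₁ z hz).congr_of_eventuallyEq (eventually_of_mem (hΩ₁.mem_nhds hz) hΩ₁eq)
  have hlim : Tendsto h (cocompact ℂ) (𝓝 0) := by
    have h2 : Tendsto h₁ (cocompact ℂ) (𝓝 0) := by
      rw [show (0 : ℂ) = ∑ _k : ι, 0 from Finset.sum_const_zero.symm]
      exact tendsto_finsetSum _ fun k _ =>
        tendsto_intervalIntegral_div_sub_cocompact (hγ k) ((hφ k).mul (hFγ k))
    exact h2.congr' (hbdd.mono fun z hz => (hΩ₁eq z hz).symm)
  have hzero : h a = 0 := hent.apply_eq_of_tendsto_cocompact a hlim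
  rw [hΩeq a haΩ] at hzero
  -- at `z = a` the difference quotient of `w ↦ (w - a) f w` is `f`
  rw [← hzero]
  refine Finset.sum_congr rfl fun k _ => intervalIntegral.integral_congr fun t ht => ?_
  rw [hI] at ht
  rcases eq_or_ne (γ k t) a with h1 | h1
  · have hfa := (hf.differentiableAt (hΩ.mem_nhds haΩ)).hasDerivAt
    have hFa : HasDerivAt F (1 * f a + (a - a) * deriv f a) a :=
      ((hasDerivAt_id a).sub_const a).mul hfa
    simp only [h1, dslope_same, hFa.deriv]
    ring
  · have h1' := sub_ne_zero.2 h1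
    rw [dslope_of_ne F h1, slope_def_field]
    simp only [hFdef]
    field_simp
    ring

/-! ### Planes in the Clifford algebra and multiplication operators -/

namespace Cl

variable {d : ℕ}

theorem coord_eA (A B : Finset (Fin d)) : coord B (eA A) = if A = B then 1 else 0 := by
  rw [coord, ← basis_apply, Module.Basis.coord_apply, Module.Basis.repr_self,
    Finsupp.single_apply]

theorem sum_coord_smul_eA (s : Cl d) : ∑ A, coord A s • eA A = s := by
  conv_rhs => rw [← (basis d).sum_repr s]
  exact Finset.sum_congr rfl fun A _ => by rw [basis_apply]; rfl

theorem coord_eq_coord_empty (A : Finset (Fin d)) (s : Cl d) :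
    coord A s = coord ∅ (star (eA A) * s) := by
  simp [coord_star_mul, coord_eA]

/-- In the coordinates given by the `e_A`, left multiplication by `conj(s)` is the transpose of left
multiplication by `s`. -/
theorem coord_mul_eA_star (s : Cl d) (A C : Finset (Fin d)) :
    coord A (star s * eA C) = coord C (s * eA A) := by
  rw [coord_eq_coord_empty A, ← mul_assoc, ← star_mul, coord_star_mul, coord_eq_coord_empty C,
    coord_star_mul]
  exact Finset.sum_congr rfl fun B _ => mul_comm _ _

end Cl

namespace Paravector

variable {d : ℕ} {J : Paravector d}

theorem toCl_slice (J : Paravector d) (z : ℂ) (hJ : J 0 = 0) :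
    toCl (slice J z) = algebraMap ℝ (Cl d) z.re + z.im • toCl J := by
  simp only [toCl, slice, ofReal, hJ, map_zero, zero_add, Finset.smul_sum, PiLp.add_apply,
    PiLp.smul_apply, smul_eq_mul, mul_zero, add_zero, PiLp.single_apply]
  simp [smul_smul]

theorem toCl_eq_ι (hJ : J 0 = 0) :
    toCl J = CliffordAlgebra.ι (cliffordForm d) (fun i => J i.succ) := by
  have h : (fun i => J i.succ) = ∑ i : Fin d, J i.succ • (Pi.single i 1 : Fin d → ℝ) :=
    pi_eq_sum_univ' _
  rw [toCl, hJ, map_zero, zero_add, h, map_sum]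
  simp only [map_smul, Cl.e]

theorem toCl_mul_self (hJ : J ∈ imSphere d) : toCl J * toCl J = -1 := by
  have h : ∑ i : Fin d, J i.succ * J i.succ = 1 := by
    have h1 : ‖J‖ ^ 2 = 1 := by rw [hJ.2]; norm_num
    rw [EuclideanSpace.real_norm_sq_eq, Fin.sum_univ_succ, hJ.1] at h1
    simpa [sq] using h1
  have hq : cliffordForm d (fun i => J i.succ) = -1 := by
    simp [cliffordForm, QuadraticMap.weightedSumSquares_apply, h]
  rw [toCl_eq_ι hJ.1, CliffordAlgebra.ι_sq_scalar, hq, map_neg, map_one]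

theorem star_toCl (hJ : J ∈ imSphere d) : star (toCl J) = -toCl J := by
  rw [toCl_eq_ι hJ.1, CliffordAlgebra.star_ι]

/-- The plane `ℂ_J` is a copy of `ℂ` inside `ℝ_d`. -/
theorem toCl_slice_mul (hJ : J ∈ imSphere d) (z w : ℂ) :
    toCl (slice J z) * toCl (slice J w) = toCl (slice J (z * w)) := by
  simp only [toCl_slice J _ hJ.1, Algebra.algebraMap_eq_smul_one, add_mul, mul_add,
    smul_mul_assoc, mul_smul_comm, toCl_mul_self hJ, one_mul, mul_one, Complex.mul_re,
    Complex.mul_im]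
  module

theorem slice_apply_zero (hJ : J ∈ imSphere d) (z : ℂ) : slice J z 0 = z.re := by
  simp [slice, ofReal, hJ.1]

theorem star_toCl_slice (hJ : J ∈ imSphere d) (z : ℂ) :
    star (toCl (slice J z)) = toCl (slice J (starRingEnd ℂ z)) := by
  simp [toCl_slice J _ hJ.1, star_toCl hJ, CliffordAlgebra.star_smul]

theorem conj_slice (hJ : J ∈ imSphere d) (z : ℂ) :
    conj (slice J z) = slice J (starRingEnd ℂ z) := by
  rw [conj, im, slice_apply_zero hJ]
  simp only [slice, Complex.conj_re, Complex.conj_im]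
  module

/-- Multiplication by `-J` in `ℂ_J` corresponds to multiplication by `-i` in `ℂ`. -/
theorem toCl_slice_neg_I_mul (hJ : J ∈ imSphere d) (z : ℂ) :
    toCl (slice J z) * -toCl J = toCl (slice J (-Complex.I * z)) := by
  have h : -toCl J = toCl (slice J (-Complex.I)) := by
    rw [toCl_slice J _ hJ.1]; simp
  rw [h, toCl_slice_mul hJ, mul_comm]

theorem norm_slice_sq (hJ : J ∈ imSphere d) (z : ℂ) : ‖slice J z‖ ^ 2 = ‖z‖ ^ 2 := by
  have hort : inner ℝ (ofReal z.re : Paravector d) (z.im • J) = 0 := by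
    simp [ofReal, inner_smul_right, EuclideanSpace.inner_single_left, hJ.1]
  have h := norm_add_sq_eq_norm_sq_add_norm_sq_real hort
  rw [slice, sq, h, ← sq, ← sq, norm_smul, hJ.2, Complex.sq_norm, Complex.normSq_apply]
  simp [ofReal, sq]

theorem neg_mem_imSphere (hJ : J ∈ imSphere d) : -J ∈ imSphere d :=
  ⟨by simp [hJ.1], by rw [norm_neg, hJ.2]⟩

theorem continuous_slice (J : Paravector d) : Continuous (slice J) := by
  have h : slice J = fun z : ℂ => z.re • (ofReal 1 : Paravector d) + z.im • J := by
    funext z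
    ext i
    simp [slice, ofReal, PiLp.single_apply]
  rw [h]
  fun_prop

theorem AxiallySymmetric.slice_mem {U : Set (Paravector d)} (hU : AxiallySymmetric U)
    (hJ : J ∈ imSphere d) {z : ℂ} (hz : slice J z ∈ U) {I : Paravector d}
    (hI : I ∈ imSphere d) : slice I z ∈ U := by
  have him : ‖im (slice J z)‖ = |z.im| := by
    rw [im, slice_apply_zero hJ, slice, add_sub_cancel_left, norm_smul, hJ.2, mul_one,
      Real.norm_eq_abs]
  rcases le_total 0 z.im with h | h
  · have := hU _ hz I hI
    rwa [him, slice_apply_zero hJ, abs_of_nonneg h] at this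
  · have := hU _ hz (-I) (neg_mem_imSphere hI)
    rwa [him, slice_apply_zero hJ, abs_of_nonpos h, neg_smul_neg] at this

theorem AxiallySymmetric.slice_conj_mem {U : Set (Paravector d)} (hU : AxiallySymmetric U)
    (hJ : J ∈ imSphere d) {z : ℂ} (hz : slice J z ∈ U) : slice J (starRingEnd ℂ z) ∈ U := by
  have h := hU.slice_mem hJ hz (neg_mem_imSphere hJ)
  simpa [slice] using h

theorem AxiallySymmetric.planeSet_eq {U : Set (Paravector d)} (hU : AxiallySymmetric U)
    (hJ : J ∈ imSphere d) : planeSet U = slice J ⁻¹' U :=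
  Set.ext fun _ => ⟨fun h => h J hJ, fun h _ hI => hU.slice_mem hJ h hI⟩

end Paravector

namespace CliffordModule

variable {d : ℕ} {H : Type*} [NormedAddCommGroup H] [InnerProductSpace ℝ H]

theorem leftMul_add (s t : Cl d) :
    leftMul (H := H) (s + t) = leftMul s + leftMul t := by
  ext v C
  simp [leftMul_apply, add_mul, add_smul, Finset.sum_add_distrib]

theorem leftMul_smul (c : ℝ) (s : Cl d) :
    leftMul (H := H) (c • s) = c • leftMul s := by
  ext v C
  simp [leftMul_apply, mul_smul, Finset.smul_sum]

theorem leftMul_one : leftMul (H := H) (1 : Cl d) = 1 := by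
  ext v C
  simp [leftMul_apply, Cl.coord_eA]

theorem leftMul_mul (s t : Cl d) :
    leftMul (H := H) (s * t) = leftMul s * leftMul t := by
  ext v C
  simp only [leftMul_apply, mul_apply_eq_comp, Finset.smul_sum, smul_smul]
  rw [Finset.sum_comm]
  refine Finset.sum_congr rfl fun A _ => ?_
  rw [← Finset.sum_smul]
  congr 1
  conv_lhs => rw [mul_assoc, ← Cl.sum_coord_smul_eA (t * Cl.eA A)]
  simp [Finset.mul_sum, mul_comm]

theorem leftMul_toCl_slice {J : Paravector d} (hJ : J ∈ Paravector.imSphere d) (z : ℂ) :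
    leftMul (H := H) (Paravector.toCl (Paravector.slice J z))
      = z.re • 1 + z.im • leftMul (Paravector.toCl J) := by
  rw [Paravector.toCl_slice J z hJ.1, leftMul_add, leftMul_smul,
    Algebra.algebraMap_eq_smul_one, leftMul_smul, leftMul_one]

theorem leftMul_sum {ι : Type*} (s : Finset ι) (b : ι → Cl d) :
    leftMul (H := H) (∑ i ∈ s, b i) = ∑ i ∈ s, leftMul (b i) :=
  map_sum (⟨⟨leftMul, leftMul_add⟩, leftMul_smul⟩ :
    Cl d →ₗ[ℝ] (CliffordModule d H →L[ℝ] CliffordModule d H)) b s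

theorem adjoint_leftMul [CompleteSpace H] (s : Cl d) :
    ContinuousLinearMap.adjoint (leftMul (H := H) s) = leftMul (star s) := by
  symm
  rw [ContinuousLinearMap.eq_adjoint_iff]
  intro v w
  simp only [PiLp.inner_apply, leftMul_apply, sum_inner, inner_sum, inner_smul_left,
    inner_smul_right, Cl.coord_mul_eA_star]
  rw [Finset.sum_comm]
  rfl

theorem star_leftMul_star [CompleteSpace H] (s : Cl d) :
    star (leftMul (H := H) (star s)) = leftMul s :=
  (adjoint_leftMul (star s)).trans (by rw [star_star])

end CliffordModule

/-! ### The resolvent of an element of a real Banach algebra -/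

section PlaneResolvent

variable {A : Type*} [NormedRing A] [NormedAlgebra ℝ A]

/-- The element `a² - 2 Re(z) a + |z|²`. -/
noncomputable def planeQ (a : A) (z : ℂ) : A :=
  a * a - (2 * z.re) • a + (‖z‖ ^ 2) • (1 : A)

theorem planeQ_conj (a : A) (z : ℂ) : planeQ a (starRingEnd ℂ z) = planeQ a z := by
  simp [planeQ]

theorem star_planeQ [StarRing A] [StarModule ℝ A] (a : A) (z : ℂ) :
    planeQ (star a) z = star (planeQ a z) := by
  simp [planeQ]

theorem continuous_planeQ (a : A) : Continuous (planeQ a) := by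
  unfold planeQ
  fun_prop

/-- The complex number `conj(z) ℓ(Q_z⁻¹) - ℓ(a Q_z⁻¹)`, where `Q_z = a² - 2 Re(z) a + |z|²`. It is
the `ℂ`-linear extension of `ℓ` applied to the resolvent `(z - a)⁻¹ = (conj(z) - a) Q_z⁻¹` in the
complexification of the real algebra `A`. -/
noncomputable def planeResolvent (ℓ : A →L[ℝ] ℝ) (a : A) (z : ℂ) : ℂ :=
  starRingEnd ℂ z * ℓ (Ring.inverse (planeQ a z)) - ℓ (a * Ring.inverse (planeQ a z))

theorem planeResolvent_conj (ℓ : A →L[ℝ] ℝ) (a : A) (z : ℂ) :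
    planeResolvent ℓ a (starRingEnd ℂ z) = starRingEnd ℂ (planeResolvent ℓ a z) := by
  simp [planeResolvent, planeQ_conj]

theorem commute_inverse_planeQ (a : A) (z : ℂ) : Commute a (Ring.inverse (planeQ a z)) := by
  by_cases h : IsUnit (planeQ a z)
  · obtain ⟨u, hu⟩ := h
    rw [← hu, Ring.inverse_unit]
    refine Commute.units_inv_right ?_
    rw [hu, planeQ]
    exact ((((Commute.refl a).mul_right (Commute.refl a)).sub_right
      ((Commute.refl a).smul_right _)).add_right ((Commute.one_right a).smul_right _))
  · rw [Ring.inverse_non_unit _ h]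
    exact Commute.zero_right a

variable [CompleteSpace A]

theorem isOpen_setOf_isUnit_planeQ (a : A) : IsOpen {z | IsUnit (planeQ a z)} :=
  Units.isOpen.preimage (continuous_planeQ a)

/-- The derivative of `z ↦ Q_z⁻¹` in the direction `v` is
`2 (a Re v - (Re z Re v + Im z Im v)) Q_z⁻²`. -/
theorem hasFDerivAt_inverse_planeQ {a : A} {z : ℂ} (hz : IsUnit (planeQ a z)) :
    ∃ D : ℂ →L[ℝ] A, HasFDerivAt (fun w => Ring.inverse (planeQ a w)) D z ∧
      ∀ v : ℂ, D v = (2 * v.re) • (a * (Ring.inverse (planeQ a z) * Ring.inverse (planeQ a z)))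
        - (2 * (z.re * v.re + z.im * v.im)) •
          (Ring.inverse (planeQ a z) * Ring.inverse (planeQ a z)) := by
  have hQ : HasFDerivAt (planeQ a)
      ((0 : ℂ →L[ℝ] A) - ((2 : ℝ) • Complex.reCLM).smulRight a
        + ((2 * z.re) • Complex.reCLM + (2 * z.im) • Complex.imCLM).smulRight (1 : A)) z := by
    have h1 : planeQ a = fun w : ℂ =>
        a * a - ((2 : ℝ) • Complex.reCLM) w • a + (w.re * w.re + w.im * w.im) • (1 : A) := by
      funext w
      simp [planeQ, Complex.sq_norm, Complex.normSq_apply]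
    rw [h1]
    refine ((hasFDerivAt_const _ _).sub
      (((2 : ℝ) • Complex.reCLM).hasFDerivAt.smul_const a)).add (HasFDerivAt.smul_const ?_ (1 : A))
    have hre := Complex.reCLM.hasFDerivAt (x := z)
    have him := Complex.imCLM.hasFDerivAt (x := z)
    refine ((hre.mul hre).add (him.mul him)).congr_fderiv ?_
    ext
    simp
    ring
  obtain ⟨u, hu⟩ := hz
  have hinv := hasFDerivAt_ringInverse (𝕜 := ℝ) u
  have hui : Ring.inverse (planeQ a z) = ↑u⁻¹ := by rw [← hu, Ring.inverse_unit]
  rw [hu] at hinv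
  refine ⟨_, hinv.comp z hQ, fun v => ?_⟩
  have hc : a * ↑u⁻¹ = ↑u⁻¹ * a := by rw [← hui]; exact commute_inverse_planeQ a z
  rw [hui, ← mul_assoc a, hc, mul_assoc]
  simp only [ContinuousLinearMap.comp_apply, add_apply, neg_apply,
    ContinuousLinearMap.mulLeftRight_apply, ContinuousLinearMap.smulRight_apply, smul_apply,
    Complex.reCLM_apply, Complex.imCLM_apply, smul_eq_mul, mul_add, add_mul, mul_smul_comm,
    smul_mul_assoc, mul_one, zero_sub, mul_neg, neg_mul, mul_assoc]
  module

/-- The resolvent `(conj(z) - a) Q_z⁻¹` is holomorphic. The Cauchy–Riemann equations hold because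
`Q_z⁻¹ = Q_z Q_z⁻²` expresses everything through `Q_z⁻²`, `a Q_z⁻²` and `a² Q_z⁻²`. -/
theorem differentiableAt_planeResolvent (ℓ : A →L[ℝ] ℝ) {a : A} {z : ℂ}
    (hz : IsUnit (planeQ a z)) : DifferentiableAt ℂ (planeResolvent ℓ a) z := by
  obtain ⟨D, hD, hDv⟩ := hasFDerivAt_inverse_planeQ hz
  set i := Ring.inverse (planeQ a z) with hi
  have hq : HasFDerivAt (fun w => ((ℓ (Ring.inverse (planeQ a w)) : ℝ) : ℂ))
      (Complex.ofRealCLM ∘L ℓ ∘L D) z := (Complex.ofRealCLM ∘L ℓ).hasFDerivAt.comp z hD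
  have hp : HasFDerivAt (fun w => ((ℓ (a * Ring.inverse (planeQ a w)) : ℝ) : ℂ))
      (Complex.ofRealCLM ∘L ℓ ∘L ContinuousLinearMap.mul ℝ A a ∘L D) z :=
    (Complex.ofRealCLM ∘L ℓ ∘L ContinuousLinearMap.mul ℝ A a).hasFDerivAt.comp z hD
  have hm : HasFDerivAt (planeResolvent ℓ a) _ z :=
    (((Complex.conjCLE : ℂ →L[ℝ] ℂ).hasFDerivAt (x := z)).mul hq).sub hp
  refine differentiableAt_complex_iff_differentiableAt_real.2 ⟨hm.differentiableAt, ?_⟩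
  rw [hm.fderiv]
  have hi1 : i = a * (a * (i * i)) - (2 * z.re) • (a * (i * i))
      + (z.re * z.re + z.im * z.im) • (i * i) := by
    have h : planeQ a z * i = 1 := Ring.mul_inverse_cancel _ hz
    calc i = planeQ a z * i * i := by rw [h, one_mul]
      _ = _ := by
        simp only [planeQ, add_mul, sub_mul, smul_mul_assoc, mul_assoc, one_mul, Complex.sq_norm,
          Complex.normSq_apply]
  have hℓi := congrArg ℓ hi1
  simp only [map_add, map_sub, map_smul, smul_eq_mul] at hℓi
  simp only [sub_apply, add_apply,
    smul_apply, ContinuousLinearMap.comp_apply, hDv,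
    ContinuousLinearMap.mul_apply', mul_sub, map_sub, map_smul, smul_eq_mul,
    Complex.ofRealCLM_apply, ← hi]
  rw [hℓi]
  apply Complex.ext <;> simp <;> ring

end PlaneResolvent

/-! ### Contour integrals of intrinsic functions -/

namespace SliceContour

variable {d : ℕ} {K K₁ K₂ U' : Set (Paravector d)}

theorem slice_mem_frontier (c : SliceContour K U') (k : Fin c.n) {t : ℝ}
    (ht : t ∈ Icc (0 : ℝ) 1) : slice c.J (c.γ k t) ∈ frontier c.U := by
  have h : c.γ k t ∈ ⋃ k, c.γ k '' Icc 0 1 := mem_iUnion.2 ⟨k, mem_image_of_mem _ ht⟩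
  rwa [c.image_eq] at h

theorem slice_notMem_U (c : SliceContour K U') (k : Fin c.n) {t : ℝ}
    (ht : t ∈ Icc (0 : ℝ) 1) : slice c.J (c.γ k t) ∉ c.U := by
  have h := c.slice_mem_frontier k ht
  rw [c.isOpen.frontier_eq] at h
  exact h.2

theorem slice_mem_closure (c : SliceContour K U') (k : Fin c.n) {t : ℝ}
    (ht : t ∈ Icc (0 : ℝ) 1) : slice c.J (c.γ k t) ∈ closure c.U :=
  frontier_subset_closure (c.slice_mem_frontier k ht)

theorem mem_planeSet (c : SliceContour K U') (hU' : AxiallySymmetric U') (k : Fin c.n) {t : ℝ}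
    (ht : t ∈ Icc (0 : ℝ) 1) : c.γ k t ∈ planeSet U' := by
  rw [hU'.planeSet_eq c.J_mem]
  exact c.closure_subset (c.slice_mem_closure k ht)

theorem continuousOn_γ (c : SliceContour K U') (k : Fin c.n) : ContinuousOn (c.γ k) (Icc 0 1) :=
  (c.contDiffOn k).continuousOn

theorem continuousOn_derivWithin_γ (c : SliceContour K U') (k : Fin c.n) :
    ContinuousOn (derivWithin (c.γ k) (Icc 0 1)) (Icc 0 1) :=
  (c.contDiffOn k).continuousOn_derivWithin (uniqueDiffOn_Icc zero_lt_one) le_rfl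

/-- The set `U` of a contour is bounded in the plane `ℂ_J`: the winding number tends to zero at
infinity, while it is one on `U`, and the boundary of `U` in `ℂ_J` is compact. -/
theorem eventually_slice_notMem_closure (c : SliceContour K U') :
    ∀ᶠ z in cocompact ℂ, slice c.J z ∉ closure c.U := by
  have h1 : Tendsto (fun w => ∑ k, ∫ t in (0 : ℝ)..1,
      derivWithin (c.γ k) (Icc 0 1) t / (c.γ k t - w)) (cocompact ℂ) (𝓝 0) := by
    rw [show (0 : ℂ) = ∑ _k : Fin c.n, 0 from Finset.sum_const_zero.symm]
    exact tendsto_finsetSum _ fun k _ =>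
      tendsto_intervalIntegral_div_sub_cocompact (c.continuousOn_γ k)
        (c.continuousOn_derivWithin_γ k)
  have h2 : IsCompact (⋃ k, c.γ k '' Icc 0 1) :=
    isCompact_iUnion fun k => isCompact_Icc.image_of_continuousOn (c.continuousOn_γ k)
  filter_upwards [h1.eventually_ne Complex.two_pi_I_ne_zero.symm, h2.compl_mem_cocompact]
    with z hz hz'
  rw [closure_eq_self_union_frontier]
  rintro (h | h)
  · exact hz (c.winding_inside z h)
  · rw [c.image_eq] at hz'
    exact hz' h

/-- Together with the complex conjugate of a second contour `c₂`, the contour `c₁` has winding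
number zero around all points at which `g` may fail to be holomorphic, as conjugation reverses the
orientation. The set `ρ` stands for the points outside the spectrum. Applied to two equal contours,
the conclusion says that the integral of `g` is purely imaginary; hence, applied to two different
ones, it says that the integrals agree. -/
theorem sum_integral_add_conj_sum_integral_eq_zero (c₁ : SliceContour K₁ U')
    (c₂ : SliceContour K₂ U') (hU' : IsOpen U') (hsymm : AxiallySymmetric U') {ρ : Set ℂ}
    (hρ : IsOpen ρ) (h₁ : ∀ z ∉ ρ, slice c₁.J z ∈ c₁.U) (h₂ : ∀ z ∉ ρ, slice c₂.J z ∈ c₂.U)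
    {g : ℂ → ℂ} (hg : DifferentiableOn ℂ g (planeSet U' ∩ ρ))
    (hconj : ∀ z ∈ planeSet U', g (starRingEnd ℂ z) = starRingEnd ℂ (g z)) :
    (∑ k, ∫ t in (0 : ℝ)..1, derivWithin (c₁.γ k) (Icc 0 1) t * g (c₁.γ k t))
      + starRingEnd ℂ
        (∑ k, ∫ t in (0 : ℝ)..1, derivWithin (c₂.γ k) (Icc 0 1) t * g (c₂.γ k t)) = 0 := by
  have hcc := Complex.continuous_conj
  have hcj : ∀ {z}, slice c₂.J (starRingEnd ℂ z) ∈ c₂.U → slice c₂.J z ∈ c₂.U := fun {z} h => by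
    simpa using c₂.axiallySymmetric.slice_conj_mem c₂.J_mem h
  -- the winding numbers cancel inside both sets and vanish outside both closures
  have key := sum_integral_mul_eq_zero_of_cauchyTransform_eq_zero
    (γ := Sum.elim c₁.γ fun k t => starRingEnd ℂ (c₂.γ k t))
    (φ := Sum.elim (fun k => derivWithin (c₁.γ k) (Icc 0 1))
      fun k t => starRingEnd ℂ (derivWithin (c₂.γ k) (Icc 0 1) t))
    (Ω := planeSet U' ∩ ρ)
    (Ω₁ := (slice c₁.J ⁻¹' c₁.U ∩ slice c₂.J ⁻¹' c₂.U) ∪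
      (slice c₁.J ⁻¹' (closure c₁.U)ᶜ ∩
        starRingEnd ℂ ⁻¹' (slice c₂.J ⁻¹' (closure c₂.U)ᶜ)))
    ?_ ?_ ?_ ?_ ?_ ?_ ?_ ?_ ?_ hg
  · simp only [Fintype.sum_sum_type, Sum.elim_inl, Sum.elim_inr] at key
    rw [← key, map_sum]
    congr 1
    refine Finset.sum_congr rfl fun k _ => ?_
    rw [← intervalIntegral.intervalIntegral_conj]
    refine intervalIntegral.integral_congr fun t ht => ?_
    rw [uIcc_of_le zero_le_one] at ht
    simp only [map_mul, hconj _ (c₂.mem_planeSet hsymm k ht)]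
  · rintro (k | k)
    · exact c₁.continuousOn_γ k
    · exact hcc.comp_continuousOn (c₂.continuousOn_γ k)
  · rintro (k | k)
    · exact c₁.continuousOn_derivWithin_γ k
    · exact hcc.comp_continuousOn (c₂.continuousOn_derivWithin_γ k)
  · rw [hsymm.planeSet_eq c₁.J_mem]
    exact (hU'.preimage (continuous_slice _)).inter hρ
  · exact ((c₁.isOpen.preimage (continuous_slice _)).inter
      (c₂.isOpen.preimage (continuous_slice _))).union
      ((isClosed_closure.isOpen_compl.preimage (continuous_slice _)).inter
        ((isClosed_closure.isOpen_compl.preimage (continuous_slice _)).preimage hcc))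
  · intro z
    by_cases hz : z ∈ ρ
    · by_cases hzU : z ∈ planeSet U'
      · exact Or.inl ⟨hzU, hz⟩
      · refine Or.inr (Or.inr ⟨fun h => hzU ?_, fun h => hzU ?_⟩)
        · rw [hsymm.planeSet_eq c₁.J_mem]
          exact c₁.closure_subset h
        · rw [hsymm.planeSet_eq c₂.J_mem]
          simpa using hsymm.slice_conj_mem c₂.J_mem (c₂.closure_subset h)
    · exact Or.inr (Or.inl ⟨h₁ z hz, h₂ z hz⟩)
  · rintro (k | k) t ht
    · refine ⟨c₁.mem_planeSet hsymm k ht, ?_⟩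
      by_contra h
      exact c₁.slice_notMem_U k ht (h₁ _ h)
    · constructor
      · rw [hsymm.planeSet_eq c₂.J_mem]
        exact hsymm.slice_conj_mem c₂.J_mem (c₂.closure_subset (c₂.slice_mem_closure k ht))
      · by_contra h
        exact c₂.slice_notMem_U k ht (hcj (h₂ _ h))
  · rintro (k | k) t ht (⟨h, h'⟩ | ⟨h, h'⟩)
    · exact c₁.slice_notMem_U k ht h
    · exact h (c₁.slice_mem_closure k ht)
    · exact c₂.slice_notMem_U k ht (hcj h')
    · refine h' ?_
      simpa using c₂.slice_mem_closure k ht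
  · have htend : Tendsto (starRingEnd ℂ) (cocompact ℂ) (cocompact ℂ) :=
      Complex.conjCLE.toHomeomorph.isClosedEmbedding.tendsto_cocompact
    filter_upwards [c₁.eventually_slice_notMem_closure,
      htend.eventually c₂.eventually_slice_notMem_closure] with z hz hz'
    exact Or.inr ⟨hz, hz'⟩
  · intro w hw
    have hconj₂ : ∀ k, (∫ t in (0 : ℝ)..1, starRingEnd ℂ (derivWithin (c₂.γ k) (Icc 0 1) t) /
        (starRingEnd ℂ (c₂.γ k t) - w)) = starRingEnd ℂ (∫ t in (0 : ℝ)..1,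
          derivWithin (c₂.γ k) (Icc 0 1) t / (c₂.γ k t - starRingEnd ℂ w)) := fun k => by
      rw [← intervalIntegral.intervalIntegral_conj]
      simp
    simp only [Fintype.sum_sum_type, Sum.elim_inl, Sum.elim_inr, hconj₂, ← map_sum]
    rcases hw with ⟨h, h'⟩ | ⟨h, h'⟩
    · rw [c₁.winding_inside w h,
        c₂.winding_inside _ (c₂.axiallySymmetric.slice_conj_mem c₂.J_mem h')]
      simp [map_ofNat]
    · rw [c₁.winding_outside w h, c₂.winding_outside _ h', map_zero, add_zero]

section ArcIntegral

variable {A : Type*} [NormedRing A] [NormedAlgebra ℝ A]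

/-- The real linear map `L`, meant to be the real or the imaginary part, of
`-i dz F(z) (conj(z) - a) Q_z⁻¹` along the `k`-th arc, in the complexification of `A`. -/
noncomputable def arcIntegrand (c : SliceContour K U') (L : ℂ →L[ℝ] ℝ) (F : ℂ → ℂ) (a : A)
    (k : Fin c.n) (t : ℝ) : A :=
  L (-Complex.I * (derivWithin (c.γ k) (Icc 0 1) t * (starRingEnd ℂ (c.γ k t) * F (c.γ k t)))) •
      Ring.inverse (planeQ a (c.γ k t))
    - L (-Complex.I * (derivWithin (c.γ k) (Icc 0 1) t * F (c.γ k t))) •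
      (a * Ring.inverse (planeQ a (c.γ k t)))

/-- The integral of `arcIntegrand` along the whole contour. For `L` the real part, it is `2π` times
the value at `a` of the intrinsic function given by `F`. -/
noncomputable def arcIntegral (c : SliceContour K U') (L : ℂ →L[ℝ] ℝ) (F : ℂ → ℂ) (a : A) : A :=
  ∑ k, ∫ t in (0 : ℝ)..1, c.arcIntegrand L F a k t

theorem mul_slice_sub_mul_slice (x y x' y' : ℝ) (q p j : A) :
    q * (x • 1 + y • j) - p * (x' • 1 + y' • j) = (x • q - x' • p) + (y • q - y' • p) * j := by
  simp only [mul_add, sub_mul, mul_smul_comm, smul_mul_assoc, mul_one]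
  abel

theorem slice_mul_sub_slice_mul (x y x' y' : ℝ) (q p j : A) :
    (x • 1 + y • j) * q - (x' • 1 + y' • j) * p = (x • q - x' • p) + j * (y • q - y' • p) := by
  simp only [add_mul, mul_sub, mul_smul_comm, smul_mul_assoc, one_mul]
  abel

variable [CompleteSpace A]

theorem intervalIntegrable_arcIntegrand (c : SliceContour K U') (hsymm : AxiallySymmetric U')
    (L : ℂ →L[ℝ] ℝ) {F : ℂ → ℂ} (hF : ContinuousOn F (planeSet U')) {a : A}
    (ha : ∀ z, ¬IsUnit (planeQ a z) → slice c.J z ∈ c.U) (k : Fin c.n) :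
    IntervalIntegrable (c.arcIntegrand L F a k) volume 0 1 := by
  have hγ := c.continuousOn_γ k
  have hγ' := c.continuousOn_derivWithin_γ k
  have hFγ : ContinuousOn (fun t => F (c.γ k t)) (Icc 0 1) :=
    hF.comp hγ fun t ht => c.mem_planeSet hsymm k ht
  have hinv : ContinuousOn (fun t => Ring.inverse (planeQ a (c.γ k t))) (Icc 0 1) := by
    intro t ht
    have hu : IsUnit (planeQ a (c.γ k t)) := by
      by_contra h
      exact c.slice_notMem_U k ht (ha _ h)
    obtain ⟨D, hD, -⟩ := hasFDerivAt_inverse_planeQ hu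
    exact hD.continuousAt.comp_continuousWithinAt (hγ t ht)
  have hcγ := Complex.continuous_conj.comp_continuousOn hγ
  refine ContinuousOn.intervalIntegrable ?_
  rw [uIcc_of_le zero_le_one]
  unfold arcIntegrand
  exact ((L.continuous.comp_continuousOn (continuousOn_const.mul
    (hγ'.mul (hcγ.mul hFγ)))).smul hinv).sub
    ((L.continuous.comp_continuousOn (continuousOn_const.mul
      (hγ'.mul hFγ))).smul (continuousOn_const.mul hinv))

/-- A real functional `ℓ` turns the integral into a complex contour integral of the holomorphic
function `F * planeResolvent ℓ a`. -/
theorem apply_arcIntegral (c : SliceContour K U') (hsymm : AxiallySymmetric U')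
    (L : ℂ →L[ℝ] ℝ) {F : ℂ → ℂ} (hF : ContinuousOn F (planeSet U')) {a : A}
    (ha : ∀ z, ¬IsUnit (planeQ a z) → slice c.J z ∈ c.U) (ℓ : A →L[ℝ] ℝ) :
    ℓ (c.arcIntegral L F a) = L (-Complex.I * ∑ k, ∫ t in (0 : ℝ)..1,
      derivWithin (c.γ k) (Icc 0 1) t * (F (c.γ k t) * planeResolvent ℓ a (c.γ k t))) := by
  rw [arcIntegral, map_sum, Finset.mul_sum, map_sum]
  refine Finset.sum_congr rfl fun k _ => ?_
  have hint : IntervalIntegrable (fun t => -Complex.I * (derivWithin (c.γ k) (Icc 0 1) t *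
      (F (c.γ k t) * planeResolvent ℓ a (c.γ k t)))) volume 0 1 := by
    refine ContinuousOn.intervalIntegrable ?_
    rw [uIcc_of_le zero_le_one]
    refine continuousOn_const.mul ((c.continuousOn_derivWithin_γ k).mul
      ((hF.comp (c.continuousOn_γ k) fun t ht => c.mem_planeSet hsymm k ht).mul fun t ht => ?_))
    have hu : IsUnit (planeQ a (c.γ k t)) := by
      by_contra h
      exact c.slice_notMem_U k ht (ha _ h)
    exact (differentiableAt_planeResolvent ℓ hu).continuousAt.comp_continuousWithinAt
      (c.continuousOn_γ k t ht)
  rw [← intervalIntegral.integral_const_mul, ← L.intervalIntegral_comp_comm hint,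
    ← ℓ.intervalIntegral_comp_comm (c.intervalIntegrable_arcIntegrand hsymm L hF ha k)]
  refine intervalIntegral.integral_congr fun t _ => ?_
  simp only [arcIntegrand, map_sub, map_smul, smul_eq_mul, planeResolvent]
  set γ := c.γ k t
  set γ' := derivWithin (c.γ k) (Icc 0 1) t
  have h : -Complex.I * (γ' * (F γ * (starRingEnd ℂ γ * ℓ (Ring.inverse (planeQ a γ))
      - ℓ (a * Ring.inverse (planeQ a γ)))))
      = ℓ (Ring.inverse (planeQ a γ)) • (-Complex.I * (γ' * (starRingEnd ℂ γ * F γ)))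
        - ℓ (a * Ring.inverse (planeQ a γ)) • (-Complex.I * (γ' * F γ)) := by
    simp only [Complex.real_smul]
    ring
  rw [h, map_sub, map_smul, map_smul, smul_eq_mul, smul_eq_mul, mul_comm, mul_comm (L _)]

theorem sum_integral_planeResolvent_add_conj_eq_zero (c₁ : SliceContour K₁ U')
    (c₂ : SliceContour K₂ U') (hU' : IsOpen U') (hsymm : AxiallySymmetric U') {F : ℂ → ℂ}
    (hF : DifferentiableOn ℂ F (planeSet U'))
    (hconj : ∀ z ∈ planeSet U', F (starRingEnd ℂ z) = starRingEnd ℂ (F z)) {a : A}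
    (h₁ : ∀ z, ¬IsUnit (planeQ a z) → slice c₁.J z ∈ c₁.U)
    (h₂ : ∀ z, ¬IsUnit (planeQ a z) → slice c₂.J z ∈ c₂.U) (ℓ : A →L[ℝ] ℝ) :
    (∑ k, ∫ t in (0 : ℝ)..1,
        derivWithin (c₁.γ k) (Icc 0 1) t * (F (c₁.γ k t) * planeResolvent ℓ a (c₁.γ k t)))
      + starRingEnd ℂ (∑ k, ∫ t in (0 : ℝ)..1,
        derivWithin (c₂.γ k) (Icc 0 1) t * (F (c₂.γ k t) * planeResolvent ℓ a (c₂.γ k t))) = 0 :=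
  sum_integral_add_conj_sum_integral_eq_zero (g := fun z => F z * planeResolvent ℓ a z) c₁ c₂ hU'
    hsymm (isOpen_setOf_isUnit_planeQ a) h₁ h₂
    ((hF.mono inter_subset_left).mul fun _ hz =>
      (differentiableAt_planeResolvent ℓ hz.2).differentiableWithinAt)
    fun z hz => by rw [hconj z hz, planeResolvent_conj, map_mul]

/-- Intrinsic functions take values in the algebra `A` itself, not only in its complexification. -/
theorem arcIntegral_imCLM_eq_zero (c : SliceContour K U') (hU' : IsOpen U')
    (hsymm : AxiallySymmetric U') {F : ℂ → ℂ} (hF : DifferentiableOn ℂ F (planeSet U'))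
    (hconj : ∀ z ∈ planeSet U', F (starRingEnd ℂ z) = starRingEnd ℂ (F z)) {a : A}
    (ha : ∀ z, ¬IsUnit (planeQ a z) → slice c.J z ∈ c.U) :
    c.arcIntegral Complex.imCLM F a = 0 := by
  refine SeparatingDual.eq_zero_of_forall_dual_eq_zero (R := ℝ) fun ℓ => ?_
  have h := congrArg Complex.re
    (sum_integral_planeResolvent_add_conj_eq_zero c c hU' hsymm hF hconj ha ha ℓ)
  rw [c.apply_arcIntegral hsymm _ hF.continuousOn ha ℓ]
  simp only [Complex.add_re, Complex.conj_re, Complex.zero_re] at h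
  simp only [Complex.imCLM_apply, neg_mul, Complex.neg_im, Complex.I_mul_im]
  linarith

/-- The value of an intrinsic function at `a` does not depend on the contour, nor on the imaginary
unit of the plane in which the contour lies. -/
theorem arcIntegral_reCLM_eq (c₁ : SliceContour K₁ U') (c₂ : SliceContour K₂ U')
    (hU' : IsOpen U') (hsymm : AxiallySymmetric U') {F : ℂ → ℂ}
    (hF : DifferentiableOn ℂ F (planeSet U'))
    (hconj : ∀ z ∈ planeSet U', F (starRingEnd ℂ z) = starRingEnd ℂ (F z)) {a : A}
    (h₁ : ∀ z, ¬IsUnit (planeQ a z) → slice c₁.J z ∈ c₁.U)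
    (h₂ : ∀ z, ¬IsUnit (planeQ a z) → slice c₂.J z ∈ c₂.U) :
    c₁.arcIntegral Complex.reCLM F a = c₂.arcIntegral Complex.reCLM F a := by
  refine sub_eq_zero.1 (SeparatingDual.eq_zero_of_forall_dual_eq_zero (R := ℝ) fun ℓ => ?_)
  have h := congrArg Complex.im
    (sum_integral_planeResolvent_add_conj_eq_zero c₁ c₂ hU' hsymm hF hconj h₁ h₂ ℓ)
  rw [map_sub, c₁.apply_arcIntegral hsymm _ hF.continuousOn h₁ ℓ,
    c₂.apply_arcIntegral hsymm _ hF.continuousOn h₂ ℓ]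
  simp only [Complex.add_im, Complex.conj_im, Complex.zero_im] at h
  simp only [Complex.reCLM_apply, neg_mul, Complex.neg_re, Complex.I_mul_re]
  linarith

theorem star_arcIntegral [StarRing A] [NormedStarGroup A] [StarModule ℝ A]
    (c : SliceContour K U') (hsymm : AxiallySymmetric U') (L : ℂ →L[ℝ] ℝ) {F : ℂ → ℂ}
    (hF : ContinuousOn F (planeSet U')) {a : A}
    (ha : ∀ z, ¬IsUnit (planeQ a z) → slice c.J z ∈ c.U) :
    star (c.arcIntegral L F a) = c.arcIntegral L F (star a) := by
  rw [arcIntegral, arcIntegral, star_sum]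
  refine Finset.sum_congr rfl fun k _ => ?_
  have h := (starL' ℝ : A ≃L[ℝ] A).toContinuousLinearMap.intervalIntegral_comp_comm
    (c.intervalIntegrable_arcIntegrand hsymm L hF ha k)
  simp only [ContinuousLinearEquiv.coe_coe, starL'_apply] at h
  rw [← h]
  refine intervalIntegral.integral_congr fun t _ => ?_
  simp only [arcIntegrand, star_sub, star_smul, star_mul, star_trivial, star_planeQ,
    Ring.inverse_star]
  rw [← Ring.inverse_star, ← star_planeQ, (commute_inverse_planeQ (star a) _).eq]

theorem integral_add_mul_mul {p r : ℝ → A} (hp : IntervalIntegrable p volume 0 1)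
    (hr : IntervalIntegrable r volume 0 1) (x y : A) :
    IntervalIntegrable (fun t => (p t + r t * x) * y) volume 0 1 ∧
      ∫ t in (0 : ℝ)..1, (p t + r t * x) * y
        = ((∫ t in (0 : ℝ)..1, p t) + (∫ t in (0 : ℝ)..1, r t) * x) * y := by
  let R (z : A) : A →L[ℝ] A := (ContinuousLinearMap.mul ℝ A).flip z
  have hR : ∀ z {G : ℝ → A}, IntervalIntegrable G volume 0 1 →
      IntervalIntegrable (fun t => G t * z) volume 0 1 :=
    fun z _ hG => ⟨(R z).integrable_comp hG.1, (R z).integrable_comp hG.2⟩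
  refine ⟨hR y (hp.add (hR x hr)), ?_⟩
  have h₁ := (R x).intervalIntegral_comp_comm hr
  have h₂ := (R y).intervalIntegral_comp_comm (hp.add (hR x hr))
  rw [intervalIntegral.integral_add hp (hR x hr)] at h₂
  simp only [R, ContinuousLinearMap.flip_apply, ContinuousLinearMap.mul_apply'] at h₁ h₂
  rw [h₁] at h₂
  exact h₂

theorem integral_mul_add_mul {p r : ℝ → A} (hp : IntervalIntegrable p volume 0 1)
    (hr : IntervalIntegrable r volume 0 1) (x y : A) :
    IntervalIntegrable (fun t => y * (p t + x * r t)) volume 0 1 ∧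
      ∫ t in (0 : ℝ)..1, y * (p t + x * r t)
        = y * ((∫ t in (0 : ℝ)..1, p t) + x * ∫ t in (0 : ℝ)..1, r t) := by
  let R (z : A) : A →L[ℝ] A := ContinuousLinearMap.mul ℝ A z
  have hR : ∀ z {G : ℝ → A}, IntervalIntegrable G volume 0 1 →
      IntervalIntegrable (fun t => z * G t) volume 0 1 :=
    fun z _ hG => ⟨(R z).integrable_comp hG.1, (R z).integrable_comp hG.2⟩
  refine ⟨hR y (hp.add (hR x hr)), ?_⟩
  have h₁ := (R x).intervalIntegral_comp_comm hr
  have h₂ := (R y).intervalIntegral_comp_comm (hp.add (hR x hr))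
  rw [intervalIntegral.integral_add hp (hR x hr)] at h₂
  simp only [R, ContinuousLinearMap.mul_apply'] at h₁ h₂
  rw [h₁] at h₂
  exact h₂

end ArcIntegral
end SliceContour

/-! ### The functional calculus in terms of intrinsic functions -/

namespace Cl

theorem continuous_coord {d : ℕ} (A : Finset (Fin d)) : Continuous (coord A) := by
  have : FiniteDimensional ℝ (Cl d) := Module.Finite.of_basis (basis d)
  exact (coord A).continuous_of_finiteDimensional

end Cl

namespace Paravector

variable {d : ℕ}

/-- The complex valued function `ℓ ∘ f₀ + i ℓ ∘ f₁`. For `ℓ` a coordinate of `ℝ_d` this is the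
stem function of a component of the slice function given by `f₀` and `f₁`. -/
noncomputable def planeFun (ℓ : Cl d →ₗ[ℝ] ℝ) (f₀ f₁ : ℂ → Cl d) (z : ℂ) : ℂ :=
  ℓ (f₀ z) + Complex.I * ℓ (f₁ z)

theorem planeFun_re (ℓ : Cl d →ₗ[ℝ] ℝ) (f₀ f₁ : ℂ → Cl d) (z : ℂ) :
    (planeFun ℓ f₀ f₁ z).re = ℓ (f₀ z) := by simp [planeFun]

theorem planeFun_im (ℓ : Cl d →ₗ[ℝ] ℝ) (f₀ f₁ : ℂ → Cl d) (z : ℂ) :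
    (planeFun ℓ f₀ f₁ z).im = ℓ (f₁ z) := by simp [planeFun]

variable {U : Set (Paravector d)} {f₀ f₁ : ℂ → Cl d}

theorem IsSlicePair.planeFun_conj (h : IsSlicePair U f₀ f₁) (ℓ : Cl d →ₗ[ℝ] ℝ) {z : ℂ}
    (hz : z ∈ planeSet U) :
    planeFun ℓ f₀ f₁ (starRingEnd ℂ z) = starRingEnd ℂ (planeFun ℓ f₀ f₁ z) := by
  simp [planeFun, h.even z hz, h.odd z hz]

theorem IsSlicePair.differentiableOn_planeFun (h : IsSlicePair U f₀ f₁)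
    (hU : IsOpen (planeSet U)) {ℓ : Cl d →ₗ[ℝ] ℝ} (hℓ : Continuous ℓ) :
    DifferentiableOn ℂ (planeFun ℓ f₀ f₁) (planeSet U) := by
  intro z hz
  have h₀ := ((h.contDiffOn₀.differentiableOn one_ne_zero).differentiableAt
    (hU.mem_nhds hz)).hasFDerivAt
  have h₁ := ((h.contDiffOn₁.differentiableOn one_ne_zero).differentiableAt
    (hU.mem_nhds hz)).hasFDerivAt
  let Λ : Cl d →L[ℝ] ℂ := Complex.ofRealCLM ∘L ⟨ℓ, hℓ⟩
  have hF : HasFDerivAt (planeFun ℓ f₀ f₁)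
      (Λ ∘L fderiv ℝ f₀ z + Complex.I • (Λ ∘L fderiv ℝ f₁ z)) z :=
    (Λ.hasFDerivAt.comp z h₀).add ((Λ.hasFDerivAt.comp z h₁).const_smul Complex.I)
  refine (differentiableAt_complex_iff_differentiableAt_real.2
    ⟨hF.differentiableAt, ?_⟩).differentiableWithinAt
  rw [hF.fderiv]
  simp only [add_apply, smul_apply, ContinuousLinearMap.comp_apply, h.cauchyRiemann₁ z hz,
    h.cauchyRiemann₂ z hz, map_neg, smul_eq_mul]
  linear_combination (- Λ (fderiv ℝ f₁ z 1)) * Complex.I_mul_I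

end Paravector

namespace CliffordModule

variable {d : ℕ} {H : Type*} [NormedAddCommGroup H] [InnerProductSpace ℝ H]

theorem Q_slice {J : Paravector d} (hJ : J ∈ imSphere d)
    (T : CliffordModule d H →L[ℝ] CliffordModule d H) (z : ℂ) :
    Q (slice J z) T = planeQ T z := by
  rw [Q, planeQ, slice_apply_zero hJ, norm_slice_sq hJ]

/-- Off the `S`-spectrum, the right-linear inverse of `Q_s[T]` is in particular an inverse in the
algebra of all bounded real linear operators. -/
theorem mem_sSpectrum_of_not_isUnit {s : Paravector d}
    {T : CliffordModule d H →L[ℝ] CliffordModule d H} (h : ¬IsUnit (Q s T)) :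
    s ∈ sSpectrum T := by
  rintro ⟨R, -, h₁, h₂⟩
  exact h ⟨⟨Q s T, R, h₂, h₁⟩, rfl⟩

end CliffordModule

namespace SliceContour

variable {d : ℕ} {K U' : Set (Paravector d)} {H : Type*} [NormedAddCommGroup H]
  [InnerProductSpace ℝ H] [CompleteSpace H]

theorem ds_eq (c : SliceContour K U') (k : Fin c.n) (t : ℝ) :
    c.ds k t = toCl (slice c.J (-Complex.I * derivWithin (c.γ k) (Icc 0 1) t)) :=
  toCl_slice_neg_I_mul c.J_mem _

/-- The left calculus of `f = ∑ F_i b_i`, where the functions `F_i` map the plane `ℂ_J` to itself.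
Splitting the factors in `ℂ_J` into `x + J y`, the real coefficients `x` and `y` can be moved
past the resolvent, while `J` stays on its right. -/
theorem left_eq {ι : Type*} [Fintype ι] (c : SliceContour K U') (hsymm : AxiallySymmetric U')
    {T : CliffordModule d H →L[ℝ] CliffordModule d H} {f : Paravector d → Cl d}
    (hT : ∀ z, ¬IsUnit (planeQ T z) → slice c.J z ∈ c.U) {F : ι → ℂ → ℂ} {b : ι → Cl d}
    (hF : ∀ i, ContinuousOn (F i) (planeSet U'))
    (hf : ∀ z ∈ planeSet U', f (slice c.J z) = ∑ i, toCl (slice c.J (F i z)) * b i) :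
    c.left f T = (1 / (2 * Real.pi)) • ∑ i, (c.arcIntegral Complex.reCLM (F i) T
      + c.arcIntegral Complex.imCLM (F i) T * leftMul (toCl c.J)) * leftMul (b i) := by
  rw [left]
  congr 1
  have hint := fun (L : ℂ →L[ℝ] ℝ) i k =>
    c.intervalIntegrable_arcIntegrand hsymm L (hF i) hT k
  have hterm := fun i k => integral_add_mul_mul (hint Complex.reCLM i k)
    (hint Complex.imCLM i k) (leftMul (toCl c.J)) (leftMul (b i))
  simp only [arcIntegral, Finset.sum_mul, ← Finset.sum_add_distrib]
  rw [Finset.sum_comm]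
  refine Finset.sum_congr rfl fun k _ => ?_
  rw [← Finset.sum_congr rfl fun i _ => (hterm i k).2,
    ← intervalIntegral.integral_finsetSum fun i _ => (hterm i k).1]
  refine intervalIntegral.integral_congr fun t ht => ?_
  rw [uIcc_of_le zero_le_one] at ht
  simp only [leftResolvent, pt, conj_slice c.J_mem, Q_slice c.J_mem, ds_eq,
    hf _ (c.mem_planeSet hsymm k ht), Finset.mul_sum, ← mul_assoc, toCl_slice_mul c.J_mem,
    leftMul_sum, leftMul_mul]
  refine Finset.sum_congr rfl fun i _ => ?_
  rw [sub_mul, mul_assoc (Ring.inverse _), ← leftMul_mul, toCl_slice_mul c.J_mem]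
  congr 1
  have h : starRingEnd ℂ (c.γ k t) * (-Complex.I * derivWithin (c.γ k) (Icc 0 1) t * F i (c.γ k t))
      = -Complex.I * (derivWithin (c.γ k) (Icc 0 1) t
        * (starRingEnd ℂ (c.γ k t) * F i (c.γ k t))) := by ring
  rw [h, leftMul_toCl_slice c.J_mem, leftMul_toCl_slice c.J_mem,
    mul_assoc (-Complex.I) _ (F i (c.γ k t))]
  exact mul_slice_sub_mul_slice
    (A := CliffordModule d H →L[ℝ] CliffordModule d H) _ _ _ _ _ _ _

/-- The right calculus of `f = ∑ b_i F_i`, where the functions `F_i` map the plane `ℂ_J` to itself.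
Here `J` stays on the left of the resolvent. -/
theorem right_eq {ι : Type*} [Fintype ι] (c : SliceContour K U') (hsymm : AxiallySymmetric U')
    {T : CliffordModule d H →L[ℝ] CliffordModule d H} {f : Paravector d → Cl d}
    (hT : ∀ z, ¬IsUnit (planeQ T z) → slice c.J z ∈ c.U) {F : ι → ℂ → ℂ} {b : ι → Cl d}
    (hF : ∀ i, ContinuousOn (F i) (planeSet U'))
    (hf : ∀ z ∈ planeSet U', f (slice c.J z) = ∑ i, b i * toCl (slice c.J (F i z))) :
    c.right f T = (1 / (2 * Real.pi)) • ∑ i, leftMul (b i) * (c.arcIntegral Complex.reCLM (F i) T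
      + leftMul (toCl c.J) * c.arcIntegral Complex.imCLM (F i) T) := by
  rw [right]
  congr 1
  have hint := fun (L : ℂ →L[ℝ] ℝ) i k =>
    c.intervalIntegrable_arcIntegrand hsymm L (hF i) hT k
  have hterm := fun i k => integral_mul_add_mul (hint Complex.reCLM i k)
    (hint Complex.imCLM i k) (leftMul (toCl c.J)) (leftMul (b i))
  simp only [arcIntegral, Finset.mul_sum, ← Finset.sum_add_distrib]
  rw [Finset.sum_comm]
  refine Finset.sum_congr rfl fun k _ => ?_
  rw [← Finset.sum_congr rfl fun i _ => (hterm i k).2,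
    ← intervalIntegral.integral_finsetSum fun i _ => (hterm i k).1]
  refine intervalIntegral.integral_congr fun t ht => ?_
  rw [uIcc_of_le zero_le_one] at ht
  simp only [rightResolvent, pt, conj_slice c.J_mem, Q_slice c.J_mem, ds_eq,
    hf _ (c.mem_planeSet hsymm k ht), Finset.sum_mul, mul_assoc, toCl_slice_mul c.J_mem,
    leftMul_sum, leftMul_mul]
  refine Finset.sum_congr rfl fun i _ => ?_
  congr 1
  rw [sub_mul, mul_sub, ← mul_assoc (leftMul _), ← leftMul_mul, toCl_slice_mul c.J_mem]
  have h : F i (c.γ k t) * (-Complex.I * derivWithin (c.γ k) (Icc 0 1) t)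
      * starRingEnd ℂ (c.γ k t) = -Complex.I * (derivWithin (c.γ k) (Icc 0 1) t
        * (starRingEnd ℂ (c.γ k t) * F i (c.γ k t))) := by ring
  have h' : F i (c.γ k t) * (-Complex.I * derivWithin (c.γ k) (Icc 0 1) t)
      = -Complex.I * (derivWithin (c.γ k) (Icc 0 1) t * F i (c.γ k t)) := by ring
  rw [h, h', leftMul_toCl_slice c.J_mem, leftMul_toCl_slice c.J_mem]
  exact slice_mul_sub_slice_mul
    (A := CliffordModule d H →L[ℝ] CliffordModule d H) _ _ _ _ _ _ _


/-- The theorem for one intrinsic function: `F(T^*) = F(T)^*`, for different contours on the two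
sides. -/
theorem arcIntegral_star {K₁ K₂ : Set (Paravector d)} (c₁ : SliceContour K₁ U')
    (c₂ : SliceContour K₂ U') (hU' : IsOpen U') (hsymm : AxiallySymmetric U')
    {T : CliffordModule d H →L[ℝ] CliffordModule d H} {F : ℂ → ℂ}
    (hF : DifferentiableOn ℂ F (planeSet U'))
    (hconj : ∀ z ∈ planeSet U', F (starRingEnd ℂ z) = starRingEnd ℂ (F z))
    (h₁ : ∀ z, ¬IsUnit (planeQ (star T) z) → slice c₁.J z ∈ c₁.U)
    (h₂ : ∀ z, ¬IsUnit (planeQ T z) → slice c₂.J z ∈ c₂.U) :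
    c₁.arcIntegral Complex.reCLM F (star T) = star (c₂.arcIntegral Complex.reCLM F T) := by
  rw [c₂.star_arcIntegral hsymm _ hF.continuousOn h₂]
  refine c₁.arcIntegral_reCLM_eq c₂ hU' hsymm hF hconj h₁ fun z hz => h₂ z ?_
  rwa [star_planeQ, isUnit_star] at hz

end SliceContour

/-! ### Adjoints -/

theorem star_smul_sum_mul {A ι : Type*} [Fintype ι] [NormedRing A] [NormedAlgebra ℝ A]
    [StarRing A] [StarModule ℝ A] (r : ℝ) (x y : ι → A) :
    star (r • ∑ i, x i * y i) = r • ∑ i, star (y i) * star (x i) := by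
  simp [star_sum]

namespace SliceContour

variable {d : ℕ} {K₁ K₂ U' : Set (Paravector d)} {H : Type*} [NormedAddCommGroup H]
  [InnerProductSpace ℝ H] [CompleteSpace H] {ι : Type*} [Fintype ι]
  {T : CliffordModule d H →L[ℝ] CliffordModule d H} {f g : Paravector d → Cl d}
  {F : ι → ℂ → ℂ} {b : ι → Cl d}

/-- The left calculus of `f = ∑ F_i b_i` is `∑ F_i(T) b_i`, if the functions `F_i` are intrinsic. -/
theorem left_eq_sum (c : SliceContour K₁ U') (hU' : IsOpen U') (hsymm : AxiallySymmetric U')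
    (hT : ∀ z, ¬IsUnit (planeQ T z) → slice c.J z ∈ c.U)
    (hF : ∀ i, DifferentiableOn ℂ (F i) (planeSet U'))
    (hconj : ∀ i, ∀ z ∈ planeSet U', F i (starRingEnd ℂ z) = starRingEnd ℂ (F i z))
    (hf : ∀ z ∈ planeSet U', ∀ J ∈ imSphere d,
      f (slice J z) = ∑ i, toCl (slice J (F i z)) * b i) :
    c.left f T = (1 / (2 * Real.pi)) •
      ∑ i, c.arcIntegral Complex.reCLM (F i) T * leftMul (b i) := by
  rw [c.left_eq hsymm hT (fun i => (hF i).continuousOn) fun z hz => hf z hz c.J c.J_mem]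
  simp only [fun i => c.arcIntegral_imCLM_eq_zero hU' hsymm (hF i) (hconj i) hT, zero_mul,
    add_zero]

/-- The right calculus of `f = ∑ b_i F_i` is `∑ b_i F_i(T)`, if the functions `F_i` are
intrinsic. -/
theorem right_eq_sum (c : SliceContour K₁ U') (hU' : IsOpen U') (hsymm : AxiallySymmetric U')
    (hT : ∀ z, ¬IsUnit (planeQ T z) → slice c.J z ∈ c.U)
    (hF : ∀ i, DifferentiableOn ℂ (F i) (planeSet U'))
    (hconj : ∀ i, ∀ z ∈ planeSet U', F i (starRingEnd ℂ z) = starRingEnd ℂ (F i z))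
    (hf : ∀ z ∈ planeSet U', ∀ J ∈ imSphere d,
      f (slice J z) = ∑ i, b i * toCl (slice J (F i z))) :
    c.right f T = (1 / (2 * Real.pi)) •
      ∑ i, leftMul (b i) * c.arcIntegral Complex.reCLM (F i) T := by
  rw [c.right_eq hsymm hT (fun i => (hF i).continuousOn) fun z hz => hf z hz c.J c.J_mem]
  simp only [fun i => c.arcIntegral_imCLM_eq_zero hU' hsymm (hF i) (hconj i) hT, mul_zero,
    add_zero]

theorem left_star_eq_star_right (c₁ : SliceContour K₁ U') (c₂ : SliceContour K₂ U')
    (hU' : IsOpen U') (hsymm : AxiallySymmetric U')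
    (h₁ : ∀ z, ¬IsUnit (planeQ (star T) z) → slice c₁.J z ∈ c₁.U)
    (h₂ : ∀ z, ¬IsUnit (planeQ T z) → slice c₂.J z ∈ c₂.U)
    (hF : ∀ i, DifferentiableOn ℂ (F i) (planeSet U'))
    (hconj : ∀ i, ∀ z ∈ planeSet U', F i (starRingEnd ℂ z) = starRingEnd ℂ (F i z))
    (hf : ∀ z ∈ planeSet U', ∀ J ∈ imSphere d,
      f (slice J z) = ∑ i, toCl (slice J (F i z)) * b i)
    (hg : ∀ z ∈ planeSet U', ∀ J ∈ imSphere d,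
      g (slice J z) = ∑ i, star (b i) * toCl (slice J (F i z))) :
    c₁.left f (star T) = star (c₂.right g T) := by
  rw [c₁.left_eq_sum hU' hsymm h₁ hF hconj hf, c₂.right_eq_sum hU' hsymm h₂ hF hconj hg,
    star_smul_sum_mul (A := CliffordModule d H →L[ℝ] CliffordModule d H)]
  congr 1
  refine Finset.sum_congr rfl fun i _ => ?_
  exact congrArg₂ (· * ·) (c₁.arcIntegral_star c₂ hU' hsymm (hF i) (hconj i) h₁ h₂)
    (star_leftMul_star _).symm

theorem right_star_eq_star_left (c₁ : SliceContour K₁ U') (c₂ : SliceContour K₂ U')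
    (hU' : IsOpen U') (hsymm : AxiallySymmetric U')
    (h₁ : ∀ z, ¬IsUnit (planeQ (star T) z) → slice c₁.J z ∈ c₁.U)
    (h₂ : ∀ z, ¬IsUnit (planeQ T z) → slice c₂.J z ∈ c₂.U)
    (hF : ∀ i, DifferentiableOn ℂ (F i) (planeSet U'))
    (hconj : ∀ i, ∀ z ∈ planeSet U', F i (starRingEnd ℂ z) = starRingEnd ℂ (F i z))
    (hf : ∀ z ∈ planeSet U', ∀ J ∈ imSphere d,
      f (slice J z) = ∑ i, b i * toCl (slice J (F i z)))
    (hg : ∀ z ∈ planeSet U', ∀ J ∈ imSphere d,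
      g (slice J z) = ∑ i, toCl (slice J (F i z)) * star (b i)) :
    c₁.right f (star T) = star (c₂.left g T) := by
  rw [c₁.right_eq_sum hU' hsymm h₁ hF hconj hf, c₂.left_eq_sum hU' hsymm h₂ hF hconj hg,
    star_smul_sum_mul (A := CliffordModule d H →L[ℝ] CliffordModule d H)]
  congr 1
  refine Finset.sum_congr rfl fun i _ => ?_
  exact congrArg₂ (· * ·) (star_leftMul_star _).symm
    (c₁.arcIntegral_star c₂ hU' hsymm (hF i) (hconj i) h₁ h₂)

end SliceContour

end

open Paravector CliffordModule ContinuousLinearMap in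
theorem mainTheorem3 (d : ℕ) {H : Type*} [NormedAddCommGroup H] [InnerProductSpace ℝ H]
    [CompleteSpace H] (T : CliffordModule d H →L[ℝ] CliffordModule d H) (hT : IsRightLinear T)
    (U' : Set (Paravector d)) (hU' : IsOpen U') (hU'_symm : AxiallySymmetric U')
    (hTU' : sSpectrum T ⊆ U') (f : Paravector d → Cl d) :
    (LeftSliceHyperholomorphic U' f →
      ∀ (c : SliceContour (sSpectrum (adjoint T)) U') (c' : SliceContour (sSpectrum T) U'),
        c.left f (adjoint T) = adjoint (c'.right (sharp f) T)) ∧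
    (RightSliceHyperholomorphic U' f →
      ∀ (c : SliceContour (sSpectrum (adjoint T)) U') (c' : SliceContour (sSpectrum T) U'),
        c.right f (adjoint T) = adjoint (c'.left (sharp f) T)) ∧
    (Intrinsic U' f →
      ∀ (c : SliceContour (sSpectrum (adjoint T)) U') (c' : SliceContour (sSpectrum T) U'),
        c.left f (adjoint T) = adjoint (c'.left f T) ∧
        c.left f (adjoint T) = adjoint (c'.right f T) ∧
        c.right f (adjoint T) = adjoint (c'.left f T) ∧
        c.right f (adjoint T) = adjoint (c'.right f T)) := by
  have hspec : ∀ {S : CliffordModule d H →L[ℝ] CliffordModule d H}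
      (c : SliceContour (sSpectrum S) U') (z : ℂ), ¬IsUnit (planeQ S z) → slice c.J z ∈ c.U :=
    fun c z hz => c.subset_U (mem_sSpectrum_of_not_isUnit (by rwa [Q_slice c.J_mem]))
  have hopen : ∀ {J : Paravector d}, J ∈ imSphere d → IsOpen (planeSet U') := fun hJ => by
    rw [hU'_symm.planeSet_eq hJ]
    exact hU'.preimage (continuous_slice _)
  have hmem : ∀ {z : ℂ} {J : Paravector d}, J ∈ imSphere d → z ∈ planeSet U' →
      starRingEnd ℂ z ∈ planeSet U' := fun {z J} hJ hz => by
    rw [hU'_symm.planeSet_eq hJ] at hz ⊢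
    exact hU'_symm.slice_conj_mem hJ hz
  refine ⟨?_, ?_, ?_⟩
  · rintro ⟨f₀, f₁, hp, hf⟩ c c'
    have hF : ∀ z ∈ planeSet U', ∀ J ∈ imSphere d, f (slice J z) =
        ∑ A, toCl (slice J (planeFun (Cl.coord A) f₀ f₁ z)) * Cl.eA A := by
      intro z hz J hJ
      simp only [toCl_slice J _ hJ.1, planeFun_re, planeFun_im, add_mul, Finset.sum_add_distrib,
        Algebra.algebraMap_eq_smul_one, smul_mul_assoc, one_mul, ← mul_smul_comm,
        ← Finset.mul_sum, Cl.sum_coord_smul_eA, hf z hz J hJ]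
    refine SliceContour.left_star_eq_star_right c c' hU' hU'_symm (hspec c) (hspec c')
      (fun A => hp.differentiableOn_planeFun (hopen c.J_mem) (Cl.continuous_coord A))
      (fun A z hz => hp.planeFun_conj _ hz) hF fun z hz J hJ => ?_
    rw [sharp, conj_slice hJ, hF _ (hmem hJ hz) J hJ, star_sum]
    refine Finset.sum_congr rfl fun A _ => ?_
    rw [star_mul, star_toCl_slice hJ, hp.planeFun_conj _ hz, Complex.conj_conj]
  · rintro ⟨f₀, f₁, hp, hf⟩ c c'
    have hF : ∀ z ∈ planeSet U', ∀ J ∈ imSphere d, f (slice J z) =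
        ∑ A, Cl.eA A * toCl (slice J (planeFun (Cl.coord A) f₀ f₁ z)) := by
      intro z hz J hJ
      simp only [toCl_slice J _ hJ.1, planeFun_re, planeFun_im, mul_add, Finset.sum_add_distrib,
        Algebra.algebraMap_eq_smul_one, mul_smul_comm, mul_one, ← smul_mul_assoc,
        ← Finset.sum_mul, Cl.sum_coord_smul_eA, hf z hz J hJ]
    refine SliceContour.right_star_eq_star_left c c' hU' hU'_symm (hspec c) (hspec c')
      (fun A => hp.differentiableOn_planeFun (hopen c.J_mem) (Cl.continuous_coord A))
      (fun A z hz => hp.planeFun_conj _ hz) hF fun z hz J hJ => ?_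
    rw [sharp, conj_slice hJ, hF _ (hmem hJ hz) J hJ, star_sum]
    refine Finset.sum_congr rfl fun A _ => ?_
    rw [star_mul, star_toCl_slice hJ, hp.planeFun_conj _ hz, Complex.conj_conj]
  · rintro ⟨f₀, f₁, hp, hreal, hf⟩ c c'
    -- a real valued `f₀` or `f₁` is recovered from its scalar part
    have hscal : ∀ x : Cl d, x ∈ Set.range (algebraMap ℝ (Cl d)) →
        algebraMap ℝ (Cl d) (Cl.coord ∅ x) = x := by
      rintro _ ⟨r, rfl⟩
      have h : Cl.coord ∅ (1 : Cl d) = 1 := by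
        simpa [Cl.eA] using Cl.coord_eA (∅ : Finset (Fin d)) ∅
      rw [Algebra.algebraMap_eq_smul_one r, map_smul, h, smul_eq_mul, mul_one,
        Algebra.algebraMap_eq_smul_one]
    have hF : ∀ z ∈ planeSet U', ∀ J ∈ imSphere d,
        f (slice J z) = toCl (slice J (planeFun (Cl.coord ∅) f₀ f₁ z)) := by
      intro z hz J hJ
      rw [toCl_slice J _ hJ.1, planeFun_re, planeFun_im, hscal _ (hreal z hz).1, hf z hz J hJ]
      conv_lhs => rw [← hscal _ (hreal z hz).2]
      rw [Algebra.algebraMap_eq_smul_one (Cl.coord ∅ (f₁ z)), mul_smul_comm, mul_one]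
    have hd := hp.differentiableOn_planeFun (hopen c.J_mem) (Cl.continuous_coord ∅)
    have hcj := fun z hz => hp.planeFun_conj (Cl.coord ∅) (z := z) hz
    have hFl : ∀ z ∈ planeSet U', ∀ J ∈ imSphere d, f (slice J z) =
        ∑ _i : Unit, toCl (slice J (planeFun (Cl.coord ∅) f₀ f₁ z)) * 1 := by simpa using hF
    have hFr : ∀ z ∈ planeSet U', ∀ J ∈ imSphere d, f (slice J z) =
        ∑ _i : Unit, 1 * toCl (slice J (planeFun (Cl.coord ∅) f₀ f₁ z)) := by simpa using hF
    -- with the single coefficient `1`, the sums for the left and the right calculus coincide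
    have hlr : ∀ {S : CliffordModule d H →L[ℝ] CliffordModule d H}
        (c : SliceContour (sSpectrum S) U'), c.left f S = c.right f S := fun c => by
      rw [c.left_eq_sum hU' hU'_symm (hspec c) (fun _ => hd) (fun _ => hcj) hFl,
        c.right_eq_sum hU' hU'_symm (hspec c) (fun _ => hd) (fun _ => hcj) hFr]
      simp [leftMul_one]
    have hkey : c.left f (adjoint T) = adjoint (c'.right f T) :=
      SliceContour.left_star_eq_star_right c c' hU' hU'_symm (hspec c) (hspec c')
        (fun _ => hd) (fun _ => hcj) hFl (by simpa using hF)
    rw [← hlr c, hlr c']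
    exact ⟨hkey, hkey, hkey, hkey⟩
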